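/- Call a set $X\subset\mathbb{R}^3$ a \emph{3D rep-tile} if $X$ is a piecewise linearly embedded compact connected 3-manifold (with boundary) in $\mathbb{R}^3$ with non-empty interior and, for some integer $k>1$, there are sets $X_1,\dots,X_k\subset\mathbb{R}^3$ with pairwise disjoint interiors such that $X=\bigcup_{i=1}^k X_i$, the $X_i$ are mutually congruent, and each $X_i$ is similar to $X$. \textbf{Theorem.} If $X$ is a 3D rep-tile, then its manifold boundary $\partial X$ is connected. -/

import Mathlib

open Set Topology

/-- A compact polyhedron: the underlying set of a finite geometric simplicial complex. -/
def IsCompactPolyhedron {E : Type*} [AddCommGroup E] [Module ℝ E] (P : Set E) : Prop :=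
  ∃ K : Geometry.SimplicialComplex ℝ E, K.faces.Finite ∧ K.space = P

/-- `f` is piecewise linear on the compact polyhedron `P`: some finite triangulation of `P` has
the property that `f` is affine on each of its simplices. -/
def IsPLOn {E F : Type*} [AddCommGroup E] [Module ℝ E] [AddCommGroup F] [Module ℝ F]
    (f : E → F) (P : Set E) : Prop :=
  ∃ K : Geometry.SimplicialComplex ℝ E, K.faces.Finite ∧ K.space = P ∧
    ∀ s ∈ K.faces, ∃ A : E →ᵃ[ℝ] F, EqOn f A (convexHull ℝ (s : Set E))

/-- The closed upper half-space of `ℝⁿ` (the points with non-negative `0`-th coordinate). -/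
def upperHalfSpace (n : ℕ) [NeZero n] : Set (EuclideanSpace ℝ (Fin n)) :=
  {y | 0 ≤ y 0}

/-- A piecewise linear chart of `X ⊆ ℝⁿ` around `x`, with values in the closed half-space: a
compact polyhedral neighbourhood `N` of `x` in `X` with a piecewise linear injection `h` of `N`
onto a neighbourhood of `h x` in the half-space. (As `N` is compact, `h` is a homeomorphism
onto its image, and its inverse is piecewise linear as well.) -/
structure IsPLChartAt {n : ℕ} [NeZero n] (X : Set (EuclideanSpace ℝ (Fin n)))
    (x : EuclideanSpace ℝ (Fin n)) (N : Set (EuclideanSpace ℝ (Fin n)))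
    (h : EuclideanSpace ℝ (Fin n) → EuclideanSpace ℝ (Fin n)) : Prop where
  mem : x ∈ N
  subset : N ⊆ X
  nhds : N ∈ 𝓝[X] x
  isPLOn : IsPLOn h N
  injOn : InjOn h N
  image_subset : h '' N ⊆ upperHalfSpace n
  image_nhds : h '' N ∈ 𝓝[upperHalfSpace n] (h x)

/-- `X ⊆ ℝⁿ` is a piecewise linearly embedded compact `n`-manifold (with possibly empty
boundary): a compact polyhedron that has a piecewise linear half-space chart around each of its
points. -/
def IsCompactPLManifold {n : ℕ} [NeZero n] (X : Set (EuclideanSpace ℝ (Fin n))) : Prop :=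
  IsCompactPolyhedron X ∧ ∀ x ∈ X, ∃ N h, IsPLChartAt X x N h

/-- The manifold boundary of `X`: the points that some chart around them sends to the bounding
hyperplane of the half-space. -/
def manifoldBoundary {n : ℕ} [NeZero n] (X : Set (EuclideanSpace ℝ (Fin n))) :
    Set (EuclideanSpace ℝ (Fin n)) :=
  {x | ∃ N h, IsPLChartAt X x N h ∧ h x 0 = 0}

/-- Two subsets of a metric space are congruent if an isometry of the space onto itself carries
one onto the other. -/
def AreCongruent {E : Type*} [PseudoEMetricSpace E] (A B : Set E) : Prop :=
  ∃ e : E ≃ᵢ E, e '' A = B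

/-- Two subsets of a metric space are similar if a similarity of the space onto itself (a
bijection that multiplies all distances by one positive constant) carries one onto the other. -/
def AreSimilar {E : Type*} [PseudoEMetricSpace E] (A B : Set E) : Prop :=
  ∃ e : E ≃ᵈ E, e '' A = B

/-- `X` is an `n`-dimensional `k`-index rep-tile: it has non-empty interior and is the union of
`k` mutually congruent sets with pairwise disjoint interiors, each similar to `X`. -/
def IsRepTile {n : ℕ} (k : ℕ) (X : Set (EuclideanSpace ℝ (Fin n))) : Prop :=
  (interior X).Nonempty ∧
    ∃ T : Fin k → Set (EuclideanSpace ℝ (Fin n)),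
      X = ⋃ i, T i ∧
      (∀ i j, i ≠ j → Disjoint (interior (T i)) (interior (T j))) ∧
      (∀ i j, AreCongruent (T i) (T j)) ∧
      ∀ i, AreSimilar (T i) X

/-- A 3D rep-tile: a connected, piecewise linearly embedded compact 3-manifold in `ℝ³` that is a
`k`-index rep-tile for some `k > 1`. -/
def Is3DRepTile (X : Set (EuclideanSpace ℝ (Fin 3))) : Prop :=
  IsCompactPLManifold X ∧ IsConnected X ∧ ∃ k : ℕ, 1 < k ∧ IsRepTile k X

/-! By invariance of domain, proved here for PL maps (`IsPLOn.image_mem_nhds_iff`), the manifold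
boundary of `X` is its frontier, i.e. the intersection of `X` with the closure of `Xᶜ`. Euclidean
space is unicoherent (`isPreconnected_inter_of_union_eq_univ`), so this intersection is connected as
soon as `Xᶜ` is. What remains is to exclude cavities of `X` (`unboundedComplement_eq_compl`).

Suppose there is a cavity. Iterating the tiling yields arbitrarily small congruent tiles, so some
tile `T i` lies in a ball contained in `X`. Its own cavity lies in that ball, hence is covered by
other tiles; tile interiors are connected and cannot cross `T i`, so some `T j` has its interior
inside the cavity. Let `U` and `U'` be the unbounded components of the complements of `T i` and `T
j`. Then `U ⊆ U'`, and since their complements are congruent of finite volume, `U = U'`. Hence the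
frontier of `U` lies in both tiles, and in the closures of three disjoint open sets: `U` and the two
tile interiors.

For polyhedral sets this is impossible (`false_of_common_polyhedral_boundary`): at a generic
frontier point a single hyperplane cuts a small ball into two sides, and three sets cannot each own
a side. "Generic" means off a finite union of codimension-two subspaces, whose complement is
connected and dense; the same fact drives the proof of domain invariance. -/

/-! ### Unicoherence of simply connected spaces. -/

section Connectedness

/-- A preconnected set that misses the frontier of `t` lies in `t` or misses `t`. -/
theorem IsPreconnected.subset_or_disjoint_of_disjoint_frontier {α : Type*} [TopologicalSpace α]
    {s t : Set α} (hs : IsPreconnected s) (h : Disjoint s (frontier t)) :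
    s ⊆ t ∨ Disjoint s t := by
  have hcov : s ⊆ interior t ∪ (closure t)ᶜ := by
    intro x hx
    by_cases hx1 : x ∈ interior t
    · exact Or.inl hx1
    · exact Or.inr fun hx2 => disjoint_left.1 h hx ⟨hx2, hx1⟩
  rcases isPreconnected_iff_subset_of_disjoint.1 hs _ _ isOpen_interior isClosed_closure.isOpen_compl
    hcov (by
      rw [eq_empty_iff_forall_notMem]
      exact fun x hx => hx.2.2 (subset_closure (interior_subset hx.2.1))) with h1 | h1
  · exact Or.inl (h1.trans interior_subset)
  · exact Or.inr (disjoint_left.2 fun x hx hxt => h1 hx (subset_closure hxt))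

/-- Unicoherence: if a simply connected, locally path connected normal space is the union of two
connected closed sets, then their intersection is connected. -/
theorem isPreconnected_inter_of_union_eq_univ {α : Type*} [TopologicalSpace α] [NormalSpace α]
    [SimplyConnectedSpace α] [LocallyPathConnectedSpace α] {A B : Set α}
    (hAc : IsClosed A) (hBc : IsClosed B) (hA : IsPreconnected A) (hB : IsPreconnected B)
    (hAB : A ∪ B = univ) : IsPreconnected (A ∩ B) := by
  rw [isPreconnected_closed_iff]
  by_contra hcon
  push Not at hcon
  obtain ⟨C, D, hC, hD, hcov, ⟨c, hcAB, hcC⟩, ⟨d, hdAB, hdD⟩, hemp⟩ := hcon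
  -- Urysohn function: 0 on the part of `A ∩ B` in `C`, 1 on the part in `D`.
  obtain ⟨u, hu0, hu1, -⟩ := exists_continuous_zero_one_of_isClosed
    ((hAc.inter hBc).inter hC) ((hAc.inter hBc).inter hD) (by
      rw [disjoint_left]
      rintro x ⟨hx1, hx2⟩ ⟨-, hx3⟩
      exact eq_empty_iff_forall_notMem.1 hemp x ⟨hx1, hx2, hx3⟩)
  classical
  have hpi : ∀ x ∈ A ∩ B, Circle.exp (Real.pi * u x) = Circle.exp (-(Real.pi * u x)) := by
    intro x hx
    rcases hcov hx with h | h
    · have : u x = 0 := hu0 ⟨hx, h⟩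
      simp [this]
    · have : u x = 1 := hu1 ⟨hx, h⟩
      rw [this, mul_one, Circle.exp_eq_exp]
      exact ⟨1, by push_cast; ring⟩
  -- `f` follows the upper half circle over `A` and the lower one over `B`; the two agree on `A ∩
  -- B`, where `u` is 0 or 1.
  let f : α → Circle := fun x => if x ∈ A then Circle.exp (Real.pi * u x)
    else Circle.exp (-(Real.pi * u x))
  have hfA : EqOn f (fun x => Circle.exp (Real.pi * u x)) A := fun x hx => if_pos hx
  have hfB : EqOn f (fun x => Circle.exp (-(Real.pi * u x))) B := by
    intro x hx
    by_cases h : x ∈ A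
    · exact (hfA h).trans (hpi x ⟨h, hx⟩)
    · exact if_neg h
  have hf : Continuous f := by
    rw [← continuousOn_univ, ← hAB]
    refine ContinuousOn.union_of_isClosed ?_ ?_ hAc hBc
    · exact (by fun_prop : Continuous _).continuousOn.congr hfA
    · exact (by fun_prop : Continuous _).continuousOn.congr hfB
  obtain ⟨t, ht⟩ := Circle.exp_surjective (f c)
  obtain ⟨g, ⟨-, hg⟩, -⟩ := Circle.isCoveringMap_exp.existsUnique_continuousMap_lifts ⟨f, hf⟩ c t
    ht
  have hg' : ∀ x, Circle.exp (g x) = f x := fun x => congrFun hg x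
  -- Two real lifts of `f` differ by a multiple of `2π`, so by a constant on a connected set.
  have key : ∀ (S : Set α) (v : α → ℝ), IsPreconnected S → Continuous v →
      EqOn f (fun x => Circle.exp (v x)) S → ∀ x ∈ S, ∀ y ∈ S, g x - v x = g y - v y := by
    intro S v hS hv hfv x hx y hy
    have hZ : MapsTo (fun x => (g x - v x) / (2 * Real.pi)) S (range ((↑) : ℤ → ℝ)) := by
      intro z hz
      obtain ⟨m, hm⟩ := Circle.exp_eq_exp.1 ((hg' z).trans (hfv hz))
      refine ⟨m, ?_⟩
      have := Real.pi_ne_zero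
      simp only [hm]
      field_simp
      ring
    have hcont : ContinuousOn (fun x => (g x - v x) / (2 * Real.pi)) S := by fun_prop
    have hsub := (hS.image _ hcont)
    have hss : Set.Subsingleton ((fun x => (g x - v x) / (2 * Real.pi)) '' S) := by
      have hdisc : IsTotallyDisconnected (range ((↑) : ℤ → ℝ)) :=
        (countable_range _).isTotallyDisconnected
      exact hdisc _ (image_subset_iff.2 hZ) hsub
    have := hss (mem_image_of_mem _ hx) (mem_image_of_mem _ hy)
    have hp := Real.pi_ne_zero
    field_simp at this
    exact this
  -- From `c` to `d` the lift `g` would change by `π` along `A` and by `-π` along `B`.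
  have h1 := key A (fun x => Real.pi * u x) hA (by fun_prop) hfA c hcAB.1 d hdAB.1
  have h2 := key B (fun x => -(Real.pi * u x)) hB (by fun_prop) hfB c hcAB.2 d hdAB.2
  have hc : u c = 0 := hu0 ⟨hcAB, hcC⟩
  have hd : u d = 1 := hu1 ⟨hdAB, hdD⟩
  simp only [hc, hd] at h1 h2
  have := Real.pi_pos
  linarith

end Connectedness

/-! ### Hyperplane arrangements and their codimension-two singular sets. -/

section Hyperplanes

variable {E : Type*} [NormedAddCommGroup E] [NormedSpace ℝ E]

theorem AffineMap.exists_linear_eq_one {f : E →ᵃ[ℝ] ℝ} (hf : f.linear ≠ 0) :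
    ∃ u : E, f.linear u = 1 := by
  obtain ⟨v, hv⟩ := DFunLike.ne_iff.1 hf
  exact ⟨(f.linear v)⁻¹ • v, by simpa using inv_mul_cancel₀ hv⟩

theorem AffineMap.apply_add_smul (f : E →ᵃ[ℝ] ℝ) (x u : E) (t : ℝ) :
    f (x + t • u) = f x + t * f.linear u := by
  rw [add_comm x, ← vadd_eq_add, f.map_vadd, map_smul, vadd_eq_add, smul_eq_mul, add_comm]

theorem tendsto_add_smul (x u : E) : Filter.Tendsto (fun t : ℝ => x + t • u) (𝓝[≠] 0) (𝓝 x) := by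
  have : Continuous fun t : ℝ => x + t • u := by fun_prop
  simpa using (this.tendsto 0).mono_left nhdsWithin_le_nhds

theorem AffineMap.dense_compl_zeros {f : E →ᵃ[ℝ] ℝ} (hf : f.linear ≠ 0) :
    Dense {x | f x = 0}ᶜ := by
  obtain ⟨u, hu⟩ := f.exists_linear_eq_one hf
  intro x
  by_cases hx : f x = 0
  · refine mem_closure_of_tendsto (tendsto_add_smul x u) ?_
    filter_upwards [self_mem_nhdsWithin] with t ht
    simpa [f.apply_add_smul, hx, hu] using ht
  · exact subset_closure hx

/-- The pairs of independent functionals from `F`; their common zeros form the singular set of the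
hyperplane arrangement `F`. -/
def independentPairs (F : Set (E →ᵃ[ℝ] ℝ)) : Set ((E →ᵃ[ℝ] ℝ) × (E →ᵃ[ℝ] ℝ)) :=
  {p ∈ F ×ˢ F | LinearIndependent ℝ ![p.1.linear, p.2.linear]}

theorem finite_independentPairs {F : Set (E →ᵃ[ℝ] ℝ)} (hF : F.Finite) :
    (independentPairs F).Finite :=
  (hF.prod hF).subset (sep_subset _ _)

variable [FiniteDimensional ℝ E]

theorem AffineMap.isClosed_zeros (f : E →ᵃ[ℝ] ℝ) : IsClosed {x | f x = 0} :=
  isClosed_eq f.continuous_of_finiteDimensional continuous_const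

/-- Finitely many hyperplanes have a dense complement. -/
theorem dense_compl_iUnion_zeros {F : Set (E →ᵃ[ℝ] ℝ)} (hF : F.Finite)
    (h : ∀ f ∈ F, f.linear ≠ 0) : Dense {x | ∀ f ∈ F, f x ≠ 0} := by
  have : {x : E | ∀ f ∈ F, f x ≠ 0} = ⋂ f ∈ F, {x | f x = 0}ᶜ := by ext; simp
  rw [this]
  exact dense_biInter_of_isOpen (fun f _ => f.isClosed_zeros.isOpen_compl) hF.countable
    fun f hf => AffineMap.dense_compl_zeros (h f hf)

/-- The complement in a convex open set of finitely many subspaces of codimension two is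
preconnected. -/
theorem isPreconnected_sdiff_codim_two {G : Set ((E →ᵃ[ℝ] ℝ) × (E →ᵃ[ℝ] ℝ))} (hG : G.Finite)
    (hind : ∀ p ∈ G, LinearIndependent ℝ ![p.1.linear, p.2.linear]) {W : Set E} (hW : Convex ℝ W)
    (hWo : IsOpen W) : IsPreconnected {x ∈ W | ∀ p ∈ G, ¬ (p.1 x = 0 ∧ p.2 x = 0)} := by
  -- `φ a p` vanishes on the hyperplane through `a` and the common zeros of `p`; a segment from `a`
  -- to a point off that hyperplane misses those zeros.
  let φ : E → (E →ᵃ[ℝ] ℝ) × (E →ᵃ[ℝ] ℝ) → E →ᵃ[ℝ] ℝ := fun a p => p.2 a • p.1 - p.1 a • p.2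
  have hφ : ∀ a, ∀ p ∈ G, ¬ (p.1 a = 0 ∧ p.2 a = 0) → (φ a p).linear ≠ 0 := by
    intro a p hp ha h0
    have h1 : p.2 a • p.1.linear + (- p.1 a) • p.2.linear = 0 := by
      ext v
      have h1 := DFunLike.congr_fun h0 v
      simp only [φ, AffineMap.sub_linear, AffineMap.smul_linear, LinearMap.sub_apply,
        LinearMap.smul_apply, LinearMap.zero_apply, LinearMap.add_apply, smul_eq_mul] at h1 ⊢
      linarith
    obtain ⟨h2, h3⟩ := LinearIndependent.pair_iff.1 (hind p hp) _ _ h1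
    exact ha ⟨neg_eq_zero.1 h3, h2⟩
  have hseg : ∀ a r, (∀ p ∈ G, ¬ (p.1 a = 0 ∧ p.2 a = 0)) → (∀ p ∈ G, φ a p r ≠ 0) →
      ∀ z ∈ segment ℝ a r, ∀ p ∈ G, ¬ (p.1 z = 0 ∧ p.2 z = 0) := by
    rintro a r ha hr z hz p hp ⟨hz1, hz2⟩
    rw [segment_eq_image'] at hz
    obtain ⟨t, -, rfl⟩ := hz
    have hrv : ∀ f : E →ᵃ[ℝ] ℝ, f (a + t • (r - a)) = f a + t * (f r - f a) := by
      intro f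
      rw [f.apply_add_smul]
      congr 2
      simpa using f.linearMap_vsub r a
    have ht : t ≠ 0 := by
      rintro rfl
      exact ha p hp ⟨by simpa using hz1, by simpa using hz2⟩
    rw [hrv] at hz1 hz2
    apply hr p hp
    have : t * φ a p r = 0 := by
      simp only [φ, AffineMap.coe_sub, AffineMap.coe_smul, Pi.sub_apply, Pi.smul_apply, smul_eq_mul]
      linear_combination (p.2 a) * hz1 - (p.1 a) * hz2
    exact (mul_eq_zero.1 this).resolve_left ht
  refine isPreconnected_of_forall_pair ?_
  rintro a ⟨haW, ha⟩ b ⟨hbW, hb⟩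
  -- A generic `r` is visible from both `a` and `b`, giving a path of two segments.
  have hd : Dense {x | ∀ f ∈ φ a '' G ∪ φ b '' G, f x ≠ 0} := by
    refine dense_compl_iUnion_zeros ((hG.image _).union (hG.image _)) ?_
    rintro f (⟨p, hp, rfl⟩ | ⟨p, hp, rfl⟩)
    · exact hφ a p hp (ha p hp)
    · exact hφ b p hp (hb p hp)
  obtain ⟨r, hr, hrW⟩ := hd.exists_mem_open hWo ⟨a, haW⟩
  refine ⟨segment ℝ a r ∪ segment ℝ b r, ?_, Or.inl (left_mem_segment ..),
    Or.inr (left_mem_segment ..), ?_⟩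
  · rintro z (hz | hz)
    · exact ⟨hW.segment_subset haW hrW hz,
        hseg a r ha (fun p hp => hr _ (Or.inl ⟨p, hp, rfl⟩)) z hz⟩
    · exact ⟨hW.segment_subset hbW hrW hz,
        hseg b r hb (fun p hp => hr _ (Or.inr ⟨p, hp, rfl⟩)) z hz⟩
  · exact IsPreconnected.union r (right_mem_segment ..) (right_mem_segment ..)
      (convex_segment ..).isPreconnected (convex_segment ..).isPreconnected

/-- Finitely many subspaces of codimension two have a dense complement. -/
theorem dense_compl_codim_two {G : Set ((E →ᵃ[ℝ] ℝ) × (E →ᵃ[ℝ] ℝ))} (hG : G.Finite)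
    (hind : ∀ p ∈ G, LinearIndependent ℝ ![p.1.linear, p.2.linear]) :
    Dense {x | ∀ p ∈ G, ¬ (p.1 x = 0 ∧ p.2 x = 0)} := by
  refine (dense_compl_iUnion_zeros (hG.image Prod.fst) ?_).mono ?_
  · rintro f ⟨p, hp, rfl⟩
    exact (hind p hp).ne_zero 0
  · exact fun x hx p hp h => hx p.1 ⟨p, hp, rfl⟩ h.1

/-- Near a point off the singular set, the arrangement looks like (at most) one hyperplane. -/
theorem exists_functional_of_nonsingular [Nontrivial E] {F : Set (E →ᵃ[ℝ] ℝ)} (hF : F.Finite)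
    (h : ∀ f ∈ F, f.linear ≠ 0) {x : E}
    (hx : ∀ p ∈ independentPairs F, ¬ (p.1 x = 0 ∧ p.2 x = 0)) :
    ∃ f : E →ᵃ[ℝ] ℝ, f.linear ≠ 0 ∧ f x = 0 ∧
      ∀ᶠ z in 𝓝 x, f z ≠ 0 → ∀ g ∈ F, g z ≠ 0 := by
  have hnear : ∀ᶠ z in 𝓝 x, ∀ g ∈ F, g x ≠ 0 → g z ≠ 0 := by
    rw [hF.eventually_all]
    intro g _
    by_cases hg : g x = 0
    · simp [hg]
    · filter_upwards [g.isClosed_zeros.isOpen_compl.mem_nhds hg] with z hz _ using hz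
  by_cases h0 : ∃ f ∈ F, f x = 0
  · obtain ⟨f, hfF, hfx⟩ := h0
    refine ⟨f, h f hfF, hfx, ?_⟩
    filter_upwards [hnear] with z hz hfz g hgF
    by_cases hgx : g x = 0
    -- At a nonsingular point, every other functional vanishing there is proportional to `f`.
    · have hdep : ¬ LinearIndependent ℝ ![f.linear, g.linear] := fun hi =>
        hx (f, g) ⟨⟨hfF, hgF⟩, hi⟩ ⟨hfx, hgx⟩
      intro hgz
      apply hdep
      rw [LinearIndependent.pair_iff]
      intro s t hst
      have h1 : ∀ k : E →ᵃ[ℝ] ℝ, k x = 0 → k.linear (z - x) = k z := by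
        intro k hk
        simpa [hk] using k.linearMap_vsub z x
      have h2 := DFunLike.congr_fun hst (z - x)
      simp only [LinearMap.add_apply, LinearMap.smul_apply, h1 f hfx, h1 g hgx, hgz,
        LinearMap.zero_apply, smul_eq_mul, mul_zero, add_zero, mul_eq_zero, hfz, or_false] at h2
      subst h2
      simpa [h g hgF] using hst
    · exact hz g hgF hgx
  · push Not at h0
    obtain ⟨l, hl0⟩ := exists_ne (0 : Module.Dual ℝ E)
    refine ⟨l.toAffineMap - AffineMap.const ℝ E (l x), by simpa using hl0, by simp, ?_⟩
    filter_upwards [hnear] with z hz _ g hgF using hz g hgF (h0 g hgF)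

end Hyperplanes

/-! ### Invariance of domain for piecewise affine maps. -/

section DomainInvariance

variable {E : Type*} [NormedAddCommGroup E] [NormedSpace ℝ E]

/-- A half of a convex set that avoids a hyperplane arrangement lies in, or off, any set with
frontier in the arrangement. -/
theorem halfBall_subset_or_disjoint {F : Set (E →ᵃ[ℝ] ℝ)} {f : E →ᵃ[ℝ] ℝ} {B P : Set E}
    (hB : Convex ℝ B) (hloc : ∀ z ∈ B, f z ≠ 0 → ∀ g ∈ F, g z ≠ 0)
    (hP : frontier P ⊆ {x | ∃ g ∈ F, g x = 0}) :
    {z ∈ B | 0 < f z} ⊆ P ∨ Disjoint {z ∈ B | 0 < f z} P := by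
  refine IsPreconnected.subset_or_disjoint_of_disjoint_frontier ?_ ?_
  · exact (hB.inter ((convex_Ioi (0 : ℝ)).affine_preimage f)).isPreconnected
  · refine disjoint_left.2 fun z hz hzP => ?_
    obtain ⟨g, hgF, hgz⟩ := hP hzP
    exact hloc z hz.1 hz.2.ne' g hgF hgz

theorem mem_closure_halfBall {f : E →ᵃ[ℝ] ℝ} (hf : f.linear ≠ 0) {B : Set E} {x : E}
    (hB : B ∈ 𝓝 x) (hx : 0 ≤ f x) : x ∈ closure {z ∈ B | 0 < f z} := by
  obtain ⟨u, hu⟩ := f.exists_linear_eq_one hf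
  have hc : Continuous fun t : ℝ => x + t • u := by fun_prop
  have ht : Filter.Tendsto (fun t : ℝ => x + t • u) (𝓝[>] 0) (𝓝 x) := by
    simpa using (hc.tendsto 0).mono_left nhdsWithin_le_nhds
  refine mem_closure_of_tendsto ht ?_
  filter_upwards [self_mem_nhdsWithin, ht hB] with t ht0 htB
  refine ⟨htB, ?_⟩
  rw [f.apply_add_smul, hu, mul_one]
  exact add_pos_of_nonneg_of_pos hx ht0

theorem closedHalfBall_subset {f : E →ᵃ[ℝ] ℝ} (hf : f.linear ≠ 0) {B P : Set E} (hB : IsOpen B)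
    (hP : IsClosed P) (h : {z ∈ B | 0 < f z} ⊆ P) : {z ∈ B | 0 ≤ f z} ⊆ P :=
  fun _ hz => closure_minimal h hP (mem_closure_halfBall hf (hB.mem_nhds hz.1) hz.2)

/-- If two affine automorphisms agree near a point on a hyperplane, then they distort the
transversal direction by a constant factor relative to each other. -/
theorem exists_transversal_factor {f : E →ᵃ[ℝ] ℝ} (hf : f.linear ≠ 0) {A : E ≃ᵃ[ℝ] E} {B : Set E}
    {x : E} (hB : B ∈ 𝓝 x) (hx : f x = 0) (hA : ∀ z ∈ B, f z = 0 → A z = z) :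
    ∃ c : ℝ, c ≠ 0 ∧ ∀ z, f (A z) = c * f z := by
  obtain ⟨u, hu⟩ := f.exists_linear_eq_one hf
  have hAx : A x = x := hA x (mem_of_mem_nhds hB) hx
  have hlin : ∀ v, A (x + v) = x + A.linear v := by
    intro v
    rw [add_comm x v, ← vadd_eq_add, A.map_vadd, hAx, vadd_eq_add, add_comm]
  have hker : ∀ v, f.linear v = 0 → A.linear v = v := by
    intro v hv
    obtain ⟨t, htB, ht0⟩ := (((tendsto_add_smul x v).eventually hB).and self_mem_nhdsWithin).exists
    have h1 := hA (x + t • v) htB (by rw [f.apply_add_smul, hx, hv]; simp)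
    rw [hlin, map_smul, add_right_inj] at h1
    exact smul_right_injective E ht0 h1
  have hflin : ∀ v, f (x + v) = f.linear v := by
    intro v
    simpa [hx] using f.apply_add_smul x v 1
  -- Split `v` along `u` and the kernel of `f.linear`, which `A.linear` fixes.
  have hfac : ∀ v, f.linear (A.linear v) = f.linear (A.linear u) * f.linear v := by
    intro v
    have h1 := hker (v - f.linear v • u) (by simp [hu])
    rw [map_sub, map_smul, sub_eq_iff_eq_add] at h1
    rw [h1]
    simp [hu]; ring
  refine ⟨f.linear (A.linear u), fun h0 => ?_, fun z => ?_⟩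
  · apply hf
    ext v
    obtain ⟨w, rfl⟩ := A.linear.surjective v
    simp [hfac w, h0]
  · have h1 := hlin (z - x)
    rw [add_sub_cancel] at h1
    rw [h1, hflin, hfac, ← hflin (z - x), add_sub_cancel]

variable [FiniteDimensional ℝ E]

theorem AffineEquiv.continuous_toFun_of_finiteDimensional (A : E ≃ᵃ[ℝ] E) : Continuous A :=
  (A : E →ᵃ[ℝ] E).continuous_of_finiteDimensional

/-- An injective piecewise affine map is open at the nonsingular points. -/
theorem image_mem_nhds_of_nonsingular [Nontrivial E] {ι : Type*} {P : ι → Set E}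
    (hPc : ∀ i, IsClosed (P i)) {F : Set (E →ᵃ[ℝ] ℝ)} (hF : F.Finite)
    (hF0 : ∀ f ∈ F, f.linear ≠ 0) (hPF : ∀ i, frontier (P i) ⊆ {x | ∃ g ∈ F, g x = 0})
    {A : ι → E ≃ᵃ[ℝ] E} {h : E → E} (hA : ∀ i, EqOn h (A i) (P i)) (hinj : InjOn h (⋃ i, P i))
    {x : E} (hx : ∀ p ∈ independentPairs F, ¬ (p.1 x = 0 ∧ p.2 x = 0))
    (hN : ⋃ i, P i ∈ 𝓝 x) {D : Set E} (hD : D ∈ 𝓝 x) : h '' D ∈ 𝓝 (h x) := by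
  obtain ⟨f, hf, hfx, hloc⟩ := exists_functional_of_nonsingular hF hF0 hx
  obtain ⟨ε, hε, hball⟩ := Metric.eventually_nhds_iff_ball.1
    (hloc.and ((Filter.eventually_mem_set.2 hN).and (Filter.eventually_mem_set.2 hD)))
  have hxB : Metric.ball x ε ∈ 𝓝 x := Metric.ball_mem_nhds x hε
  have hhalf : ∀ f' : E →ᵃ[ℝ] ℝ, f'.linear ≠ 0 → f' x = 0 →
      (∀ z ∈ Metric.ball x ε, f' z ≠ 0 → ∀ g ∈ F, g z ≠ 0) →
      ∃ i, {z ∈ Metric.ball x ε | 0 ≤ f' z} ⊆ P i := by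
    intro f' hf' hfx' hloc'
    obtain ⟨z, hz⟩ := closure_nonempty_iff.1 ⟨x, mem_closure_halfBall hf' hxB hfx'.ge⟩
    obtain ⟨i, hi⟩ := mem_iUnion.1 (hball z hz.1).2.1
    refine ⟨i, closedHalfBall_subset hf' Metric.isOpen_ball (hPc i) ?_⟩
    exact (halfBall_subset_or_disjoint (convex_ball x ε) hloc' (hPF i)).resolve_right
      fun hd => disjoint_left.1 hd hz hi
  obtain ⟨i, hi⟩ := hhalf f hf hfx fun z hz => (hball z hz).1
  obtain ⟨j, hj⟩ := hhalf (-f) (by simpa using hf) (by simpa using hfx)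
    fun z hz hfz => (hball z hz).1 (by simpa using hfz)
  have hj' : ∀ z ∈ Metric.ball x ε, f z ≤ 0 → z ∈ P j := fun z hz hfz => hj ⟨hz, by simpa using hfz⟩
  have hi' : ∀ z ∈ Metric.ball x ε, 0 ≤ f z → z ∈ P i := fun z hz hfz => hi ⟨hz, hfz⟩
  have hxb : x ∈ Metric.ball x ε := Metric.mem_ball_self hε
  -- `h` is `A i` on one half-ball and `A j` on the other. `T` compares these branches and fixes the
  -- separating hyperplane near `x`.
  let T : E ≃ᵃ[ℝ] E := (A j).trans (A i).symm
  have hT : ∀ z, T z = (A i).symm (A j z) := fun z => rfl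
  obtain ⟨c, hc0, hc⟩ := exists_transversal_factor hf (A := T) hxB hfx (by
    intro z hz hfz
    rw [hT, ← hA j (hj' z hz hfz.le), hA i (hi' z hz hfz.ge), AffineEquiv.symm_apply_apply])
  have hTx : T x = x := by
    rw [hT, ← hA j (hj' x hxb hfx.le), hA i (hi' x hxb hfx.ge), AffineEquiv.symm_apply_apply]
  -- If `c < 0`, then `h` folds: a point `z` of the negative side and `T z` on the positive side
  -- have the same image.
  have hcpos : 0 < c := by
    by_contra hcn
    have hcneg : c < 0 := lt_of_le_of_ne (not_lt.1 hcn) hc0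
    have hmem : Metric.ball x ε ∩ T ⁻¹' Metric.ball x ε ∈ 𝓝 x := by
      refine Filter.inter_mem hxB
        (T.continuous_toFun_of_finiteDimensional.continuousAt.preimage_mem_nhds ?_)
      rwa [hTx]
    obtain ⟨z, ⟨hz1, hz2⟩, hz3⟩ := closure_nonempty_iff.1
      ⟨x, mem_closure_halfBall (f := -f) (by simpa using hf) hmem (by simp [hfx])⟩
    have hz3 : f z < 0 := by simpa using hz3
    have hfT : 0 < f (T z) := by rw [hc]; exact mul_pos_of_neg_of_neg hcneg hz3
    have hzP := hj' z hz1 hz3.le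
    have hTP := hi' _ hz2 hfT.le
    have heq : h (T z) = h z := by
      rw [hA i hTP, hA j hzP, hT, AffineEquiv.apply_symm_apply]
    have := hinj (mem_iUnion_of_mem i hTP) (mem_iUnion_of_mem j hzP) heq
    rw [this] at hfT
    exact lt_asymm hz3 hfT
  have hti : Filter.Tendsto (A i).symm (𝓝 (h x)) (𝓝 x) := by
    have := ((A i).symm.continuous_toFun_of_finiteDimensional).tendsto (A i x)
    rwa [AffineEquiv.symm_apply_apply, ← hA i (hi' x hxb hfx.ge)] at this
  have htj : Filter.Tendsto (A j).symm (𝓝 (h x)) (𝓝 x) := by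
    have := ((A j).symm.continuous_toFun_of_finiteDimensional).tendsto (A j x)
    rwa [AffineEquiv.symm_apply_apply, ← hA j (hj' x hxb hfx.le)] at this
  -- Pull `y` back along `A i`; if the result is on the wrong side, `c > 0` puts the pullback along
  -- `A j` on the right side for that branch.
  filter_upwards [hti hxB, htj hxB] with y hyi hyj
  rcases le_or_gt 0 (f ((A i).symm y)) with hy | hy
  · exact ⟨_, (hball _ hyi).2.2, by rw [hA i (hi' _ hyi hy), AffineEquiv.apply_symm_apply]⟩
  · have h1 : (A i).symm y = T ((A j).symm y) := by rw [hT, AffineEquiv.apply_symm_apply]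
    rw [h1, hc] at hy
    have hy' := neg_of_mul_neg_right hy hcpos.le
    exact ⟨_, (hball _ hyj).2.2, by rw [hA j (hj' _ hyj hy'.le), AffineEquiv.apply_symm_apply]⟩

/-- The composition of an affine functional with the inverse of an affine automorphism. -/
def AffineEquiv.pushFunctional (A : E ≃ᵃ[ℝ] E) (f : E →ᵃ[ℝ] ℝ) : E →ᵃ[ℝ] ℝ :=
  f.comp (A.symm : E →ᵃ[ℝ] E)

omit [FiniteDimensional ℝ E] in
theorem AffineEquiv.pushFunctional_apply (A : E ≃ᵃ[ℝ] E) (f : E →ᵃ[ℝ] ℝ) (x : E) :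
    A.pushFunctional f (A x) = f x := by
  simp [AffineEquiv.pushFunctional]

omit [FiniteDimensional ℝ E] in
theorem AffineEquiv.linear_pushFunctional_ne_zero (A : E ≃ᵃ[ℝ] E) {f : E →ᵃ[ℝ] ℝ}
    (hf : f.linear ≠ 0) : (A.pushFunctional f).linear ≠ 0 := by
  obtain ⟨u, hu⟩ := f.exists_linear_eq_one hf
  intro h0
  have := DFunLike.congr_fun h0 (A.linear u)
  simp [AffineEquiv.pushFunctional, hu] at this

omit [FiniteDimensional ℝ E] in
theorem AffineEquiv.linearIndependent_pushFunctional (A : E ≃ᵃ[ℝ] E) {f g : E →ᵃ[ℝ] ℝ}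
    (h : LinearIndependent ℝ ![f.linear, g.linear]) :
    LinearIndependent ℝ ![(A.pushFunctional f).linear, (A.pushFunctional g).linear] := by
  rw [LinearIndependent.pair_iff] at h ⊢
  intro s t hst
  refine h s t ?_
  ext v
  have := DFunLike.congr_fun hst (A.linear v)
  simpa [AffineEquiv.pushFunctional] using this

/-- Domain invariance for piecewise affine maps. -/
theorem image_mem_nhds_of_piecewise_affine [Nontrivial E] {ι : Type*} [Finite ι] {P : ι → Set E}
    (hPc : ∀ i, IsClosed (P i)) {F : Set (E →ᵃ[ℝ] ℝ)} (hF : F.Finite)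
    (hF0 : ∀ f ∈ F, f.linear ≠ 0) (hPF : ∀ i, frontier (P i) ⊆ {x | ∃ g ∈ F, g x = 0})
    {A : ι → E ≃ᵃ[ℝ] E} {h : E → E} (hA : ∀ i, EqOn h (A i) (P i)) (hinj : InjOn h (⋃ i, P i))
    {x : E} (hN : ⋃ i, P i ∈ 𝓝 x) : h '' (⋃ i, P i) ∈ 𝓝 (h x) := by
  have hcont : ContinuousOn h (⋃ i, P i) :=
    (locallyFinite_of_finite P).continuousOn_iUnion hPc fun i =>
      (A i).continuous_toFun_of_finiteDimensional.continuousOn.congr (hA i)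
  obtain ⟨δ, hδ, hDN⟩ := Metric.nhds_basis_closedBall.mem_iff.1 hN
  set D := Metric.closedBall x δ with hDdef
  have hDc : IsCompact (h '' D) := (isCompact_closedBall x δ).image_of_continuousOn (hcont.mono hDN)
  have hSc : IsCompact (h '' Metric.sphere x δ) :=
    (isCompact_sphere x δ).image_of_continuousOn
      (hcont.mono (Metric.sphere_subset_closedBall.trans hDN))
  have hxS : h x ∉ h '' Metric.sphere x δ := by
    rintro ⟨z, hz, hzx⟩
    have := hinj (hDN (Metric.sphere_subset_closedBall hz)) (mem_of_mem_nhds hN) hzx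
    rw [this, Metric.mem_sphere, dist_self] at hz
    exact hδ.ne hz
  obtain ⟨η, hη, hW⟩ := Metric.isOpen_iff.1 hSc.isClosed.isOpen_compl _ hxS
  set W := Metric.ball (h x) η
  let G : Set ((E →ᵃ[ℝ] ℝ) × (E →ᵃ[ℝ] ℝ)) :=
    ⋃ i, (fun p => ((A i).pushFunctional p.1, (A i).pushFunctional p.2)) '' independentPairs F
  have hG : G.Finite := finite_iUnion fun i => (finite_independentPairs hF).image _
  have hind : ∀ p ∈ G, LinearIndependent ℝ ![p.1.linear, p.2.linear] := by
    intro p hp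
    obtain ⟨i, q, hq, rfl⟩ := mem_iUnion.1 hp
    exact (A i).linearIndependent_pushFunctional hq.2
  have hdense := dense_compl_codim_two hG hind
  have hdense' := dense_compl_codim_two (finite_independentPairs hF)
    fun p (hp : p ∈ independentPairs F) => hp.2
  have hopen : ∀ z ∈ Metric.ball x δ,
      (∀ p ∈ independentPairs F, ¬ (p.1 z = 0 ∧ p.2 z = 0)) → h '' D ∈ 𝓝 (h z) := by
    intro z hz hzs
    have hDz : D ∈ 𝓝 z := Filter.mem_of_superset (Metric.isOpen_ball.mem_nhds hz)
      Metric.ball_subset_closedBall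
    exact image_mem_nhds_of_nonsingular hPc hF hF0 hPF hA hinj hzs
      (Filter.mem_of_superset hDz hDN) hDz
  -- `W` misses the image of the sphere, so in `W` the compact set `h '' D` can have frontier points
  -- only among images of singular points. Off these, `W` is connected, so it lies in `h '' D` or
  -- misses it.
  have hconn := isPreconnected_sdiff_codim_two hG hind (convex_ball (h x) η) Metric.isOpen_ball
  rcases hconn.subset_or_disjoint_of_disjoint_frontier (t := h '' D) (by
    refine disjoint_left.2 ?_
    rintro y ⟨hyW, hy⟩ ⟨hycl, hyint⟩
    rw [hDc.isClosed.closure_eq] at hycl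
    obtain ⟨z, hz, rfl⟩ := hycl
    apply hyint
    rw [mem_interior_iff_mem_nhds]
    refine hopen z ?_ ?_
    · refine lt_of_le_of_ne (Metric.mem_closedBall.1 hz) fun hzs => ?_
      exact hW hyW ⟨z, hzs, rfl⟩
    · rintro p hp hpz
      obtain ⟨i, hi⟩ := mem_iUnion.1 (hDN hz)
      refine hy ((A i).pushFunctional p.1, (A i).pushFunctional p.2)
        (mem_iUnion_of_mem i ⟨p, hp, rfl⟩) ?_
      rw [hA i hi]
      simpa only [AffineEquiv.pushFunctional_apply] using hpz) with hsub | hdis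
  · have hWY : W ⊆ h '' D := by
      intro y hy
      rw [← hDc.isClosed.closure_eq]
      refine closure_mono hsub ?_
      have := hdense.open_subset_closure_inter Metric.isOpen_ball hy
      exact this
    exact Filter.mem_of_superset (Metric.ball_mem_nhds _ hη) (hWY.trans (image_mono hDN))
  -- Nonsingular points near `x` have images interior to `h '' D` and lying in `W`, so `W` cannot
  -- miss it.
  · exfalso
    have hpre : Metric.ball x δ ∩ h ⁻¹' W ∈ 𝓝 x :=
      Filter.inter_mem (Metric.ball_mem_nhds x hδ)
        ((hcont.continuousAt hN).preimage_mem_nhds (Metric.ball_mem_nhds _ hη))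
    obtain ⟨O, hO, hOo, hxO⟩ := mem_nhds_iff.1 hpre
    obtain ⟨z, hzs, hzO⟩ := hdense'.exists_mem_open hOo ⟨x, hxO⟩
    have hnz := hopen z (hO hzO).1 hzs
    obtain ⟨O', hO', hOo', hzO'⟩ := mem_nhds_iff.1
      (Filter.inter_mem hnz (Metric.isOpen_ball.mem_nhds (hO hzO).2))
    obtain ⟨y, hys, hyO⟩ := hdense.exists_mem_open hOo' ⟨_, hzO'⟩
    exact disjoint_left.1 hdis ⟨(hO' hyO).2, hys⟩ (hO' hyO).1

/-- For an injective piecewise affine map, a point is interior to the domain if and only if its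
image is interior to the range. -/
theorem image_mem_nhds_iff_of_piecewise_affine [Nontrivial E] {ι : Type*} [Finite ι]
    {P : ι → Set E} (hPc : ∀ i, IsClosed (P i)) {F : Set (E →ᵃ[ℝ] ℝ)} (hF : F.Finite)
    (hF0 : ∀ f ∈ F, f.linear ≠ 0) (hPF : ∀ i, frontier (P i) ⊆ {x | ∃ g ∈ F, g x = 0})
    {A : ι → E ≃ᵃ[ℝ] E} {h : E → E} (hA : ∀ i, EqOn h (A i) (P i)) (hinj : InjOn h (⋃ i, P i))
    {x : E} (hx : x ∈ ⋃ i, P i) : h '' (⋃ i, P i) ∈ 𝓝 (h x) ↔ ⋃ i, P i ∈ 𝓝 x := by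
  refine ⟨fun hN => ?_, image_mem_nhds_of_piecewise_affine hPc hF hF0 hPF hA hinj⟩
  have hQ : h '' (⋃ i, P i) = ⋃ i, A i '' P i := by
    rw [image_iUnion]
    exact iUnion_congr fun i => (hA i).image_eq
  set k := Function.invFunOn h (⋃ i, P i)
  have hk : ∀ z ∈ ⋃ i, P i, k (h z) = z := hinj.leftInvOn_invFunOn
  -- The inverse `k` is again injective and piecewise affine, on the image pieces.
  have key := image_mem_nhds_of_piecewise_affine (P := fun i => A i '' P i)
    (F := ⋃ i, (A i).pushFunctional '' F) (A := fun i => (A i).symm) (h := k) (x := h x)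
    (fun i => (A i).toContinuousAffineEquiv.toHomeomorph.isClosedMap _ (hPc i))
    (finite_iUnion fun i => hF.image _)
    (by
      intro f hf
      obtain ⟨i, g, hg, rfl⟩ := mem_iUnion.1 hf
      exact (A i).linear_pushFunctional_ne_zero (hF0 g hg))
    (by
      intro i
      have : frontier (A i '' P i) = A i '' frontier (P i) :=
        ((A i).toContinuousAffineEquiv.toHomeomorph.image_frontier (P i)).symm
      rw [this]
      rintro _ ⟨z, hz, rfl⟩
      obtain ⟨g, hg, hgz⟩ := hPF i hz
      exact ⟨_, mem_iUnion_of_mem i ⟨g, hg, rfl⟩, by rwa [AffineEquiv.pushFunctional_apply]⟩)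
    (by
      rintro i _ ⟨z, hz, rfl⟩
      rw [AffineEquiv.symm_apply_apply, ← hA i hz, hk z (mem_iUnion_of_mem i hz)])
    (by
      rw [← hQ]
      rintro _ ⟨z, hz, rfl⟩ _ ⟨w, hw, rfl⟩ hzw
      rw [hk z hz, hk w hw] at hzw
      rw [hzw])
    (by rwa [← hQ])
  rw [← hQ, hk x hx] at key
  convert key using 1
  ext z
  constructor
  · exact fun hz => ⟨h z, ⟨z, hz, rfl⟩, hk z hz⟩
  · rintro ⟨_, ⟨w, hw, rfl⟩, rfl⟩
    rwa [hk w hw]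

end DomainInvariance

/-! ### Polyhedral frontiers and domain invariance for PL maps. -/

section Polyhedra

variable {E : Type*} [NormedAddCommGroup E] [NormedSpace ℝ E]

/-- The frontier of `S` lies in a finite union of hyperplanes. -/
def HasPolyhedralFrontier (S : Set E) : Prop :=
  ∃ F : Set (E →ᵃ[ℝ] ℝ), F.Finite ∧ (∀ f ∈ F, f.linear ≠ 0) ∧
    frontier S ⊆ {x | ∃ g ∈ F, g x = 0}

theorem HasPolyhedralFrontier.mono {S T : Set E} (hS : HasPolyhedralFrontier S)
    (h : frontier T ⊆ frontier S) : HasPolyhedralFrontier T := by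
  obtain ⟨F, h1, h2, h3⟩ := hS
  exact ⟨F, h1, h2, h.trans h3⟩

theorem exists_common_arrangement {ι : Type*} [Finite ι] {P : ι → Set E}
    (h : ∀ i, HasPolyhedralFrontier (P i)) :
    ∃ F : Set (E →ᵃ[ℝ] ℝ), F.Finite ∧ (∀ f ∈ F, f.linear ≠ 0) ∧
      ∀ i, frontier (P i) ⊆ {x | ∃ g ∈ F, g x = 0} := by
  choose F h1 h2 h3 using h
  refine ⟨⋃ i, F i, finite_iUnion h1, ?_, fun i x hx => ?_⟩
  · intro f hf
    obtain ⟨i, hi⟩ := mem_iUnion.1 hf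
    exact h2 i f hi
  · obtain ⟨g, hg, hgx⟩ := h3 i hx
    exact ⟨g, mem_iUnion_of_mem i hg, hgx⟩

theorem frontier_iUnion_subset_of_finite {α ι : Type*} [TopologicalSpace α] [Finite ι]
    (P : ι → Set α) : frontier (⋃ i, P i) ⊆ ⋃ i, frontier (P i) := by
  rintro x ⟨hx1, hx2⟩
  rw [closure_iUnion_of_finite] at hx1
  obtain ⟨i, hi⟩ := mem_iUnion.1 hx1
  exact mem_iUnion_of_mem i ⟨hi, fun h => hx2 (interior_mono (subset_iUnion P i) h)⟩

theorem HasPolyhedralFrontier.iUnion {ι : Type*} [Finite ι] {P : ι → Set E}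
    (h : ∀ i, HasPolyhedralFrontier (P i)) : HasPolyhedralFrontier (⋃ i, P i) := by
  obtain ⟨F, h1, h2, h3⟩ := exists_common_arrangement h
  exact ⟨F, h1, h2, (frontier_iUnion_subset_of_finite P).trans (iUnion_subset h3)⟩

/-- The part of an open set covered by finitely many closed sets is covered by those that have
interior points. -/
theorem IsOpen.subset_of_subset_iUnion_closed {α ι : Type*} [TopologicalSpace α] [BaireSpace α]
    [Finite ι] {Q : ι → Set α} (hQ : ∀ i, IsClosed (Q i)) {O : Set α} (hO : IsOpen O)
    (h : O ⊆ ⋃ i, Q i) : O ⊆ ⋃ i ∈ {i | (interior (Q i)).Nonempty}, Q i := by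
  intro x hx
  by_contra hxg
  have hgc : IsClosed (⋃ i ∈ {i | (interior (Q i)).Nonempty}, Q i) :=
    (toFinite _).isClosed_biUnion fun i _ => hQ i
  have hd : Dense (⋂ i ∈ {i | ¬ (interior (Q i)).Nonempty}, (Q i)ᶜ) := by
    refine dense_biInter_of_isOpen (fun i _ => (hQ i).isOpen_compl) (toFinite _).countable ?_
    intro i hi
    rw [← interior_eq_empty_iff_dense_compl]
    exact not_nonempty_iff_eq_empty.1 hi
  obtain ⟨y, hy, hyO, hyg⟩ := hd.exists_mem_open (hO.inter hgc.isOpen_compl) ⟨x, hx, hxg⟩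
  obtain ⟨i, hi⟩ := mem_iUnion.1 (h hyO)
  by_cases hne : (interior (Q i)).Nonempty
  · exact hyg (mem_biUnion hne hi)
  · exact mem_iInter₂.1 hy i hne hi

variable [FiniteDimensional ℝ E]

omit [FiniteDimensional ℝ E] in
/-- The frontier of a simplex lies in a finite union of hyperplanes. -/
theorem hasPolyhedralFrontier_convexHull {t : Finset E}
    (ht : AffineIndependent ℝ ((↑) : t → E)) :
    HasPolyhedralFrontier (convexHull ℝ (t : Set E)) := by
  have hcl : IsClosed (convexHull ℝ (t : Set E)) := t.finite_toSet.isClosed_convexHull ℝ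
  by_cases htop : affineSpan ℝ (t : Set E) = ⊤
  · let b : AffineBasis t ℝ E := ⟨(↑), ht, by simpa using htop⟩
    have hb : range b = (t : Set E) := Subtype.range_coe
    refine ⟨{f ∈ range b.coord | f.linear ≠ 0}, (finite_range _).subset (sep_subset _ _),
      fun f hf => hf.2, ?_⟩
    · intro x hx
      rw [hcl.frontier_eq, ← hb] at hx
      have h1 := hx.1
      have h2 := hx.2
      rw [b.convexHull_eq_nonneg_coord] at h1
      rw [b.interior_convexHull] at h2
      simp only [mem_ofPred_eq, not_forall, not_lt] at h1 h2
      obtain ⟨i, hi⟩ := h2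
      -- This coordinate is not constant: it is 1 at its own vertex but nonpositive at `x`.
      refine ⟨b.coord i, ⟨mem_range_self i, fun h0 => ?_⟩, le_antisymm hi (h1 i)⟩
      have h3 := (b.coord i).linearMap_vsub (b i) x
      rw [h0, b.coord_apply_eq, LinearMap.zero_apply, vsub_eq_sub] at h3
      linarith
  · rcases t.eq_empty_or_nonempty with rfl | ⟨p, hp⟩
    · exact ⟨∅, finite_empty, by simp, by simp⟩
    have hpm : p ∈ affineSpan ℝ (t : Set E) := subset_affineSpan ℝ _ hp
    have hdir : (affineSpan ℝ (t : Set E)).direction < ⊤ := by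
      rw [lt_top_iff_ne_top, Ne, AffineSubspace.direction_eq_top_iff_of_nonempty ⟨p, hpm⟩]
      exact htop
    obtain ⟨l, hl0, hl⟩ := Submodule.exists_le_ker_of_lt_top _ hdir
    refine ⟨{l.toAffineMap - AffineMap.const ℝ E (l p)}, finite_singleton _, by simpa using hl0, ?_⟩
    intro x hx
    have hx' := convexHull_subset_affineSpan (𝕜 := ℝ) _ (hcl.frontier_subset hx)
    have := hl (AffineSubspace.vsub_mem_direction hx' hpm)
    exact ⟨_, rfl, by simpa using this⟩

omit [FiniteDimensional ℝ E] in
theorem IsCompactPolyhedron.hasPolyhedralFrontier {P : Set E} (hP : IsCompactPolyhedron P) :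
    HasPolyhedralFrontier P := by
  obtain ⟨K, hK, rfl⟩ := hP
  have := hK.to_subtype
  rw [Geometry.SimplicialComplex.space, biUnion_eq_iUnion]
  exact HasPolyhedralFrontier.iUnion fun s => hasPolyhedralFrontier_convexHull (K.indep s.2)

omit [FiniteDimensional ℝ E] in
theorem IsCompactPolyhedron.isCompact {P : Set E} (hP : IsCompactPolyhedron P) : IsCompact P := by
  obtain ⟨K, hK, rfl⟩ := hP
  exact hK.isCompact_biUnion fun s _ => s.finite_toSet.isCompact_convexHull ℝ

omit [FiniteDimensional ℝ E] in
theorem IsPLOn.isCompact {F : Type*} [AddCommGroup F] [Module ℝ F] {h : E → F} {P : Set E}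
    (hP : IsPLOn h P) : IsCompact P :=
  let ⟨K, hK, hKP, _⟩ := hP
  IsCompactPolyhedron.isCompact ⟨K, hK, hKP⟩

theorem IsPLOn.continuousOn {h : E → E} {P : Set E} (hP : IsPLOn h P) : ContinuousOn h P := by
  obtain ⟨K, hK, rfl, hA⟩ := hP
  have := hK.to_subtype
  rw [Geometry.SimplicialComplex.space, biUnion_eq_iUnion]
  refine (locallyFinite_of_finite _).continuousOn_iUnion
    (fun s => s.1.finite_toSet.isClosed_convexHull ℝ) fun s => ?_
  obtain ⟨A, hA⟩ := hA s s.2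
  exact A.continuous_of_finiteDimensional.continuousOn.congr hA

omit [FiniteDimensional ℝ E] in
theorem AffineMap.injective_of_injOn {A : E →ᵃ[ℝ] E} {S : Set E} (hA : InjOn A S)
    (hS : (interior S).Nonempty) : Function.Injective A := by
  obtain ⟨p, hp⟩ := hS
  rw [← A.linear_injective_iff, injective_iff_map_eq_zero]
  intro v hv
  obtain ⟨t, ht, ht0⟩ := (((tendsto_add_smul p v).eventually
    (mem_interior_iff_mem_nhds.1 hp)).and self_mem_nhdsWithin).exists
  have h1 : A (p + t • v) = A p := by
    rw [add_comm, ← vadd_eq_add, A.map_vadd, map_smul, hv, smul_zero, zero_vadd]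
  have h2 := hA ht (interior_subset hp) h1
  rw [add_eq_left] at h2
  exact (smul_eq_zero.1 h2).resolve_left ht0

theorem AffineMap.interior_convexHull_nonempty_of_image {A : E →ᵃ[ℝ] E} {t : Set E}
    (h : (interior (A '' convexHull ℝ t)).Nonempty) : (interior (convexHull ℝ t)).Nonempty := by
  rw [A.image_convexHull, interior_convexHull_nonempty_iff_affineSpan_eq_top,
    ← AffineSubspace.map_span] at h
  have hne : t.Nonempty := by
    rw [nonempty_iff_ne_empty]
    rintro rfl
    simp only [AffineSubspace.span_empty, AffineSubspace.map_bot] at h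
    exact AffineSubspace.bot_ne_top ℝ E E h
  have hd : (affineSpan ℝ t).direction.map A.linear = ⊤ := by
    rw [← AffineSubspace.map_direction, h, AffineSubspace.direction_top]
  rw [interior_convexHull_nonempty_iff_affineSpan_eq_top,
    ← AffineSubspace.direction_eq_top_iff_of_nonempty (hne.mono (subset_affineSpan ℝ t))]
  apply Submodule.eq_top_of_finrank_eq
  refine le_antisymm (Submodule.finrank_le _) ?_
  have := Submodule.finrank_map_le A.linear (affineSpan ℝ t).direction
  rwa [hd, finrank_top] at this

/-- Domain invariance for injective PL maps, in both directions. -/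
theorem IsPLOn.image_mem_nhds_iff [Nontrivial E] {h : E → E} {N : Set E} (hN : IsPLOn h N)
    (hinj : InjOn h N) {x : E} (hx : x ∈ N) : h '' N ∈ 𝓝 (h x) ↔ N ∈ 𝓝 x := by
  have hcont := hN.continuousOn
  have hcomp := hN.isCompact
  obtain ⟨K, hK, rfl, hA⟩ := hN
  have := hK.to_subtype
  choose! A hA using hA
  have hspace : K.space = ⋃ s : K.faces, convexHull ℝ (s.1 : Set E) := by
    rw [Geometry.SimplicialComplex.space, biUnion_eq_iUnion]
  -- Only on full-dimensional simplices does injectivity of `h` make its affine pieces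
  -- automorphisms. By Baire, the other simplices are not needed to cover the interiors of the
  -- domain and the image.
  let ι := {s : K.faces // (interior (convexHull ℝ (s.1 : Set E))).Nonempty}
  let P : ι → Set E := fun s => convexHull ℝ (s.1.1 : Set E)
  have hPN : ⋃ i, P i ⊆ K.space := by
    rw [hspace]
    exact iUnion_subset fun s => subset_iUnion (fun s : K.faces => convexHull ℝ (s.1 : Set E)) s.1
  have hPc : ∀ i, IsClosed (P i) := fun i => i.1.1.finite_toSet.isClosed_convexHull ℝ
  obtain ⟨F, hF, hF0, hPF⟩ := exists_common_arrangement (P := P) fun i =>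
    hasPolyhedralFrontier_convexHull (K.indep i.1.2)
  have hAinj : ∀ i : ι, Function.Injective (A i.1.1) := fun i => by
    refine AffineMap.injective_of_injOn (S := P i) ?_ i.2
    exact (hinj.mono ((subset_iUnion P i).trans hPN)).congr (hA i.1.1 i.1.2)
  let B : ι → E ≃ᵃ[ℝ] E := fun i => AffineEquiv.ofBijective (φ := A i.1.1) (by
    have h1 := (A i.1.1).linear_injective_iff.2 (hAinj i)
    exact (A i.1.1).linear_bijective_iff.1 ⟨h1, LinearMap.injective_iff_surjective.1 h1⟩)
  have hB : ∀ i, EqOn h (B i) (P i) := fun i => hA i.1.1 i.1.2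
  have hinj' := hinj.mono hPN
  have hsrc : interior K.space ⊆ ⋃ i, P i := by
    refine (isOpen_interior.subset_of_subset_iUnion_closed
      (fun s : K.faces => s.1.finite_toSet.isClosed_convexHull ℝ)
      (interior_subset.trans hspace.subset)).trans ?_
    exact iUnion₂_subset fun s hs => subset_iUnion P ⟨s, hs⟩
  have htgt : interior (h '' K.space) ⊆ h '' ⋃ i, P i := by
    have him : ∀ s : K.faces, h '' convexHull ℝ (s.1 : Set E) = A s.1 '' convexHull ℝ (s.1 : Set E) :=
      fun s => (hA s.1 s.2).image_eq
    refine (isOpen_interior.subset_of_subset_iUnion_closed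
      (Q := fun s : K.faces => h '' convexHull ℝ (s.1 : Set E)) (fun s => ?_) ?_).trans ?_
    · simp only [him]
      exact ((s.1.finite_toSet.isCompact_convexHull ℝ).image
        (A s.1).continuous_of_finiteDimensional).isClosed
    · refine interior_subset.trans ?_
      rw [hspace, image_iUnion]
    · refine iUnion₂_subset fun s hs => image_mono ?_
      simp only [mem_ofPred_eq, him] at hs
      exact subset_iUnion P ⟨s, AffineMap.interior_convexHull_nonempty_of_image hs⟩
  constructor
  · intro hnh
    obtain ⟨z, hz, hzx⟩ := htgt (mem_interior_iff_mem_nhds.2 hnh)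
    have hxP : x ∈ ⋃ i, P i := by rwa [← hinj (hPN hz) hx hzx]
    refine Filter.mem_of_superset ?_ hPN
    rw [← image_mem_nhds_iff_of_piecewise_affine hPc hF hF0 hPF hB hinj' hxP]
    exact Filter.mem_of_superset (interior_mem_nhds.2 hnh) htgt
  · intro hnh
    exact Filter.mem_of_superset (image_mem_nhds_of_piecewise_affine hPc hF hF0 hPF hB hinj'
      (Filter.mem_of_superset (interior_mem_nhds.2 hnh) hsrc)) (image_mono hPN)

end Polyhedra

/-! ### Boundary, frontier and interior of PL manifolds of full dimension. -/

section PLManifolds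

variable {n : ℕ} [NeZero n] {X : Set (EuclideanSpace ℝ (Fin n))}

theorem upperHalfSpace_mem_nhds_iff {y : EuclideanSpace ℝ (Fin n)} :
    upperHalfSpace n ∈ 𝓝 y ↔ 0 < y 0 := by
  have hcoord : Continuous fun z : EuclideanSpace ℝ (Fin n) => z 0 := by fun_prop
  constructor
  · intro h
    have hc : Continuous fun t : ℝ => y + t • EuclideanSpace.single (0 : Fin n) (-1 : ℝ) := by
      fun_prop
    have ht : Filter.Tendsto (fun t : ℝ => y + t • EuclideanSpace.single (0 : Fin n) (-1 : ℝ))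
        (𝓝[>] 0) (𝓝 y) := by
      simpa using (hc.tendsto 0).mono_left nhdsWithin_le_nhds
    obtain ⟨t, ht1, ht2⟩ := ((ht.eventually h).and self_mem_nhdsWithin).exists
    have h1 : 0 ≤ (y + t • EuclideanSpace.single (0 : Fin n) (-1 : ℝ)) 0 := ht1
    simp only [PiLp.add_apply, PiLp.smul_apply, PiLp.single_apply, if_true,
      smul_eq_mul] at h1
    have : (0 : ℝ) < t := ht2
    linarith
  · intro h
    exact Filter.mem_of_superset ((isOpen_lt continuous_const hcoord).mem_nhds h)
      fun z (hz : 0 < z 0) => show 0 ≤ z 0 from hz.le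

namespace IsPLChartAt

variable {x : EuclideanSpace ℝ (Fin n)} {N : Set (EuclideanSpace ℝ (Fin n))}
  {h : EuclideanSpace ℝ (Fin n) → EuclideanSpace ℝ (Fin n)}

theorem exists_ball (hc : IsPLChartAt X x N h) :
    ∃ ε > 0, Metric.ball (h x) ε ∩ upperHalfSpace n ⊆ h '' N :=
  Metric.mem_nhdsWithin_iff.1 hc.image_nhds

/-- The image of the chart is a full neighbourhood of `h z`, and domain invariance pulls this back
to `N`. -/
theorem mem_interior_of_pos (hc : IsPLChartAt X x N h) {ε : ℝ}
    (hε : Metric.ball (h x) ε ∩ upperHalfSpace n ⊆ h '' N) {z : EuclideanSpace ℝ (Fin n)}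
    (hz : z ∈ N) (hzb : h z ∈ Metric.ball (h x) ε) (hz0 : 0 < h z 0) : z ∈ interior X := by
  rw [mem_interior_iff_mem_nhds]
  refine Filter.mem_of_superset ?_ hc.subset
  rw [← hc.isPLOn.image_mem_nhds_iff hc.injOn hz]
  exact Filter.mem_of_superset
    (Filter.inter_mem (Metric.isOpen_ball.mem_nhds hzb) (upperHalfSpace_mem_nhds_iff.2 hz0)) hε

theorem pos_of_mem_nhds (hc : IsPLChartAt X x N h) {z : EuclideanSpace ℝ (Fin n)} (hz : N ∈ 𝓝 z) :
    0 < h z 0 := by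
  rw [← upperHalfSpace_mem_nhds_iff]
  exact Filter.mem_of_superset ((hc.isPLOn.image_mem_nhds_iff hc.injOn (mem_of_mem_nhds hz)).2 hz)
    hc.image_subset

theorem eventually_pos (hc : IsPLChartAt X x N h) {ε : ℝ} (hε : 0 < ε) :
    ∀ᶠ z in 𝓝[X] x, z ∈ N ∧ h z ∈ Metric.ball (h x) ε ∧ (z ∈ interior X → 0 < h z 0) := by
  have h1 : ∀ᶠ z in 𝓝[X] x, N ∈ 𝓝[X] z :=
    eventually_eventually_nhdsWithin.2 hc.nhds
  have h2 : ∀ᶠ z in 𝓝[X] x, h z ∈ Metric.ball (h x) ε := by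
    have hle : 𝓝[X] x ≤ 𝓝[N] x := nhdsWithin_le_iff.2 hc.nhds
    exact ((hc.isPLOn.continuousOn x hc.mem).mono_left hle).eventually
      (Metric.ball_mem_nhds _ hε)
  filter_upwards [h1, h2, hc.nhds] with z hz1 hz2 hz3
  refine ⟨hz3, hz2, fun hz => hc.pos_of_mem_nhds ?_⟩
  rwa [nhdsWithin_eq_nhds.2 (mem_interior_iff_mem_nhds.1 hz)] at hz1

end IsPLChartAt

theorem IsCompactPLManifold.isClosed (hX : IsCompactPLManifold X) : IsClosed X :=
  hX.1.isCompact.isClosed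

/-- The manifold boundary of a PL manifold of full dimension is its topological frontier. -/
theorem IsCompactPLManifold.manifoldBoundary_eq_frontier (hX : IsCompactPLManifold X) :
    manifoldBoundary X = frontier X := by
  rw [hX.isClosed.frontier_eq]
  ext x
  constructor
  · rintro ⟨N, h, hc, h0⟩
    refine ⟨hc.subset hc.mem, fun hx => ?_⟩
    have hN := hc.nhds
    rw [nhdsWithin_eq_nhds.2 (mem_interior_iff_mem_nhds.1 hx)] at hN
    exact (hc.pos_of_mem_nhds hN).ne' h0
  · rintro ⟨hx, hxi⟩
    obtain ⟨N, h, hc⟩ := hX.2 x hx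
    refine ⟨N, h, hc, ?_⟩
    by_contra h0
    have hpos : 0 < h x 0 :=
      lt_of_le_of_ne (hc.image_subset (mem_image_of_mem h hc.mem)) (Ne.symm h0)
    obtain ⟨ε, hε, hball⟩ := hc.exists_ball
    exact hxi (hc.mem_interior_of_pos hball hc.mem (Metric.mem_ball_self hε) hpos)

theorem exists_mem_ball_pos {y : EuclideanSpace ℝ (Fin n)} (hy : 0 ≤ y 0)
    {O : Set (EuclideanSpace ℝ (Fin n))} (hO : O ∈ 𝓝 y) : ∃ z ∈ O, 0 < z 0 := by
  have hc : Continuous fun t : ℝ => y + t • EuclideanSpace.single (0 : Fin n) (1 : ℝ) := by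
    fun_prop
  have ht : Filter.Tendsto (fun t : ℝ => y + t • EuclideanSpace.single (0 : Fin n) (1 : ℝ))
      (𝓝[>] 0) (𝓝 y) := by
    simpa using (hc.tendsto 0).mono_left nhdsWithin_le_nhds
  obtain ⟨t, ht1, ht2⟩ := ((ht.eventually hO).and self_mem_nhdsWithin).exists
  refine ⟨_, ht1, ?_⟩
  have : (0 : ℝ) < t := ht2
  simp only [PiLp.add_apply, PiLp.smul_apply, PiLp.single_apply, if_true, smul_eq_mul]
  linarith

/-- Move `h x` slightly into the open half-space. The preimage stays in `U` because the compact set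
`h '' (N \ U)` misses `h x`. -/
theorem IsCompactPLManifold.subset_closure_interior (hX : IsCompactPLManifold X) :
    X ⊆ closure (interior X) := by
  intro x hx
  obtain ⟨N, h, hc⟩ := hX.2 x hx
  obtain ⟨ε, hε, hball⟩ := hc.exists_ball
  rw [mem_closure_iff]
  intro U hU hxU
  have hcomp : IsCompact (h '' (N \ U)) := (hc.isPLOn.isCompact.diff hU).image_of_continuousOn
    (hc.isPLOn.continuousOn.mono sdiff_subset)
  have hxn : h x ∉ h '' (N \ U) := by
    rintro ⟨z, hz, hzx⟩
    exact hz.2 (hc.injOn hz.1 hc.mem hzx ▸ hxU)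
  obtain ⟨y, ⟨hy1, hy2⟩, hy0⟩ := exists_mem_ball_pos
    (hc.image_subset (mem_image_of_mem h hc.mem))
    (Filter.inter_mem (Metric.ball_mem_nhds _ hε) (hcomp.isClosed.isOpen_compl.mem_nhds hxn))
  obtain ⟨z, hz, rfl⟩ := hball ⟨hy1, hy0.le⟩
  refine ⟨z, ?_, hc.mem_interior_of_pos hball hz hy1 hy0⟩
  by_contra hzU
  exact hy2 ⟨z, ⟨hz, hzU⟩, rfl⟩

/-- On the compact set `N` the map `h` is injective and closed. -/
theorem IsPLChartAt.isPreconnected_preimage {x : EuclideanSpace ℝ (Fin n)}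
    {N : Set (EuclideanSpace ℝ (Fin n))}
    {h : EuclideanSpace ℝ (Fin n) → EuclideanSpace ℝ (Fin n)} (hc : IsPLChartAt X x N h)
    {D : Set (EuclideanSpace ℝ (Fin n))} (hD : IsPreconnected D) (hDN : D ⊆ h '' N) :
    IsPreconnected (N ∩ h ⁻¹' D) := by
  have : CompactSpace N := isCompact_iff_compactSpace.1 hc.isPLOn.isCompact
  have hclosed : IsClosedMap (N.domRestrict h) := hc.isPLOn.continuousOn.domRestrict.isClosedMap
  have h1 := hD.preimage_of_isClosedMap hc.injOn.injective hclosed (by rwa [range_domRestrict])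
  have h2 := h1.image Subtype.val continuous_subtype_val.continuousOn
  convert h2 using 1
  ext z
  simp [and_comm]

/-- The interior of a connected PL manifold is connected. -/
theorem IsCompactPLManifold.isPreconnected_interior (hX : IsCompactPLManifold X)
    (hconn : IsPreconnected X) : IsPreconnected (interior X) := by
  intro U V hU hV hUV hIU hIV
  have hcov : X ⊆ closure (interior X ∩ U) ∪ closure (interior X ∩ V) := by
    rw [← closure_union, ← inter_union_distrib_left, inter_eq_left.2 hUV]
    exact hX.subset_closure_interior
  have hmeet : ∀ {W : Set (EuclideanSpace ℝ (Fin n))}, (interior X ∩ W).Nonempty →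
      (X ∩ closure (interior X ∩ W)).Nonempty := fun ⟨z, hz⟩ =>
    ⟨z, interior_subset hz.1, subset_closure hz⟩
  -- As `X` is connected, both parts of the interior accumulate at some `x`; the open half-ball of a
  -- chart there is a connected piece of the interior meeting both.
  obtain ⟨x, hx, hxU, hxV⟩ := isPreconnected_closed_iff.1 hconn _ _ isClosed_closure
    isClosed_closure hcov (hmeet hIU) (hmeet hIV)
  obtain ⟨N, h, hc⟩ := hX.2 x hx
  obtain ⟨ε, hε, hball⟩ := hc.exists_ball
  have hev := eventually_nhdsWithin_iff.1 (hc.eventually_pos hε)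
  set D : Set (EuclideanSpace ℝ (Fin n)) := Metric.ball (h x) ε ∩ {y | 0 < y 0}
  have hDN : D ⊆ h '' N := fun y hy => hball ⟨hy.1, show 0 ≤ y 0 from le_of_lt hy.2⟩
  have hDconv : Convex ℝ D := by
    refine (convex_ball _ _).inter ?_
    exact convex_halfSpace_gt ((EuclideanSpace.proj (0 : Fin n)).toLinearMap.isLinear) 0
  have hM := hc.isPreconnected_preimage hDconv.isPreconnected hDN
  have hMI : N ∩ h ⁻¹' D ⊆ interior X := fun z hz =>
    hc.mem_interior_of_pos hball hz.1 hz.2.1 hz.2.2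
  have hpt : ∀ {W : Set (EuclideanSpace ℝ (Fin n))}, x ∈ closure (interior X ∩ W) →
      ((N ∩ h ⁻¹' D) ∩ W).Nonempty := by
    intro W hxW
    obtain ⟨z, ⟨hzI, hzW⟩, hz⟩ := ((mem_closure_iff_frequently.1 hxW).and_eventually hev).exists
    obtain ⟨h1, h2, h3⟩ := hz (interior_subset hzI)
    exact ⟨z, ⟨h1, h2, h3 hzI⟩, hzW⟩
  obtain ⟨z, hz, hzUV⟩ := hM U V hU hV (hMI.trans hUV) (hpt hxU) (hpt hxV)
  exact ⟨z, hMI hz, hzUV⟩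

end PLManifolds

/-! ### Common polyhedral boundaries and the unbounded part of a complement. -/

section Separation

variable {E : Type*} [NormedAddCommGroup E] [NormedSpace ℝ E]

/-- Three disjoint open sets with polyhedral frontiers cannot have the frontier of one of them as a
common boundary. -/
theorem false_of_common_polyhedral_boundary [FiniteDimensional ℝ E] [Nontrivial E]
    {P : Fin 3 → Set E} (hPo : ∀ i, IsOpen (P i)) (hdisj : ∀ i j, i ≠ j → Disjoint (P i) (P j))
    (hpoly : ∀ i, HasPolyhedralFrontier (P i)) (h0 : (P 0).Nonempty) (h1 : (P 1).Nonempty)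
    (hfr : ∀ i, frontier (P 0) ⊆ closure (P i)) : False := by
  obtain ⟨F, hF, hF0, hPF⟩ := exists_common_arrangement hpoly
  have hind : ∀ p ∈ independentPairs F, LinearIndependent ℝ ![p.1.linear, p.2.linear] :=
    fun p hp => hp.2
  have hdense := dense_compl_codim_two (finite_independentPairs hF) hind
  have hconn := isPreconnected_sdiff_codim_two (finite_independentPairs hF) hind
    (convex_univ (𝕜 := ℝ) (E := E)) isOpen_univ
  -- Otherwise the connected dense nonsingular set would lie in `P 0`, hence miss `P 1`, or miss `P
  -- 0`.
  obtain ⟨x, hxs, hxf⟩ : ∃ x, (∀ p ∈ independentPairs F, ¬ (p.1 x = 0 ∧ p.2 x = 0)) ∧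
      x ∈ frontier (P 0) := by
    by_contra hcon
    rcases hconn.subset_or_disjoint_of_disjoint_frontier
      (disjoint_left.2 fun x hx hxf => hcon ⟨x, hx.2, hxf⟩) with h | h
    · obtain ⟨y, hy, hy1⟩ := hdense.exists_mem_open (hPo 1) h1
      exact disjoint_left.1 (hdisj 0 1 (by decide)) (h ⟨mem_univ y, hy⟩) hy1
    · obtain ⟨y, hy, hy0⟩ := hdense.exists_mem_open (hPo 0) h0
      exact disjoint_left.1 h ⟨mem_univ y, hy⟩ hy0
  obtain ⟨f, hf, hfx, hloc⟩ := exists_functional_of_nonsingular hF hF0 hxs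
  obtain ⟨ε, hε, hball⟩ := Metric.eventually_nhds_iff_ball.1 hloc
  let φ : Bool → E →ᵃ[ℝ] ℝ := fun b => if b then f else -f
  have hφ0 : ∀ b z, φ b z ≠ 0 → f z ≠ 0 := by
    rintro (_ | _) z hz
    · simpa [φ] using hz
    · exact hz
  have hside : ∀ i, ∃ b, {z ∈ Metric.ball x ε | 0 < φ b z} ⊆ P i := by
    intro i
    obtain ⟨y, hyb, hyP⟩ := mem_closure_iff.1 (hfr i hxf) _ Metric.isOpen_ball
      (Metric.mem_ball_self hε)
    obtain ⟨z, hz, hzb, hzP⟩ := (AffineMap.dense_compl_zeros hf).exists_mem_open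
      (Metric.isOpen_ball.inter (hPo i)) ⟨y, hyb, hyP⟩
    obtain ⟨b, hb⟩ : ∃ b, 0 < φ b z := by
      rcases lt_or_gt_of_ne hz with h | h
      · exact ⟨false, by simpa [φ] using h⟩
      · exact ⟨true, h⟩
    refine ⟨b, (halfBall_subset_or_disjoint (convex_ball x ε)
      (fun w hw hfw => hball w hw (hφ0 b w hfw)) (hPF i)).resolve_right fun hd => ?_⟩
    exact disjoint_left.1 hd ⟨hzb, hb⟩ hzP
  choose b hb using hside
  -- Three sets, two sides: two disjoint sets contain the same half-ball.
  obtain ⟨i, j, hij, hbij⟩ := Fintype.exists_ne_map_eq_of_card_lt b (by simp)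
  have hφ : (φ (b i)).linear ≠ 0 := by
    cases b i
    · simpa [φ] using hf
    · simpa [φ] using hf
  have hφx : φ (b i) x = 0 := by
    cases b i
    · simpa [φ] using hfx
    · simpa [φ] using hfx
  obtain ⟨z, hz⟩ := closure_nonempty_iff.1
    ⟨x, mem_closure_halfBall hφ (Metric.ball_mem_nhds x hε) hφx.ge⟩
  exact disjoint_left.1 (hdisj i j hij) (hb i hz) (hb j (hbij ▸ hz))

/-- The union of the unbounded connected sets that miss `T`; for bounded `T` this is the unbounded
component of the complement. -/
def unboundedComplement (T : Set E) : Set E :=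
  {y | ∃ C, IsPreconnected C ∧ y ∈ C ∧ ¬ Bornology.IsBounded C ∧ Disjoint C T}

omit [NormedSpace ℝ E] in
theorem disjoint_unboundedComplement (T : Set E) : Disjoint (unboundedComplement T) T :=
  disjoint_left.2 fun _ hy hyT =>
    let ⟨_, _, hyC, _, hC⟩ := hy
    disjoint_left.1 hC hyC hyT

omit [NormedSpace ℝ E] in
/-- A set off the unbounded part of the complement has a larger unbounded part. -/
theorem unboundedComplement_subset {T T' : Set E} (h : Disjoint (unboundedComplement T) T') :
    unboundedComplement T ⊆ unboundedComplement T' := by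
  rintro y ⟨C, hC, hy, hCb, hCT⟩
  exact ⟨C, hC, hy, hCb,
    h.mono_left (show C ⊆ unboundedComplement T from fun z hz => ⟨C, hC, hz, hCb, hCT⟩)⟩

theorem mem_unboundedComplement_of_ball {T : Set E} {x y : E} {r : ℝ}
    (hr : Disjoint (Metric.ball x r) T) (hx : x ∈ unboundedComplement T)
    (hy : y ∈ Metric.ball x r) : y ∈ unboundedComplement T := by
  obtain ⟨C, hC, hxC, hCb, hCT⟩ := hx
  refine ⟨C ∪ Metric.ball x r, ?_, Or.inr hy, fun h => hCb (h.subset subset_union_left),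
    hCT.union_left hr⟩
  exact hC.union x hxC (Metric.mem_ball_self (Metric.pos_of_mem_ball hy))
    (convex_ball x r).isPreconnected

theorem isOpen_unboundedComplement {T : Set E} (hT : IsClosed T) :
    IsOpen (unboundedComplement T) := by
  rw [Metric.isOpen_iff]
  intro x hx
  obtain ⟨r, hr, hrT⟩ := Metric.isOpen_iff.1 hT.isOpen_compl x
    (disjoint_left.1 (disjoint_unboundedComplement T) hx)
  exact ⟨r, hr, fun y hy => mem_unboundedComplement_of_ball
    (disjoint_left.2 fun z hz => hrT hz) hx hy⟩

/-- A small ball off `T` that meets an unbounded connected set off `T` can be glued to it. -/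
theorem frontier_unboundedComplement_subset {T : Set E} (hT : IsClosed T) :
    frontier (unboundedComplement T) ⊆ T := by
  intro x hx
  by_contra hxT
  rw [(isOpen_unboundedComplement hT).frontier_eq] at hx
  obtain ⟨r, hr, hrT⟩ := Metric.isOpen_iff.1 hT.isOpen_compl x hxT
  obtain ⟨y, hy, hxy⟩ := Metric.mem_closure_iff.1 hx.1 (r / 2) (by positivity)
  refine hx.2 (mem_unboundedComplement_of_ball (r := r / 2) (disjoint_left.2 fun z hz => hrT ?_) hy
    (Metric.mem_ball.2 hxy))
  rw [Metric.mem_ball] at hz ⊢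
  have := dist_triangle z y x
  rw [dist_comm y x] at this
  linarith

theorem frontier_unboundedComplement_subset_frontier {T : Set E} (hT : IsClosed T) :
    frontier (unboundedComplement T) ⊆ frontier T := by
  intro x hx
  rw [hT.frontier_eq]
  refine ⟨frontier_unboundedComplement_subset hT hx, fun hxi => ?_⟩
  obtain ⟨y, hyi, hy⟩ := mem_closure_iff.1 (frontier_subset_closure hx) _ isOpen_interior hxi
  exact disjoint_left.1 (disjoint_unboundedComplement T) hy (interior_subset hyi)

/-- Lengthening every nonzero vector by `r` carries the connected punctured space onto the exterior
of the ball. -/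
theorem isPreconnected_compl_closedBall (hE : 1 < Module.rank ℝ E) (c : E) {r : ℝ} (hr : 0 ≤ r) :
    IsPreconnected (Metric.closedBall c r)ᶜ := by
  have h0 := (isConnected_compl_singleton_of_one_lt_rank hE (0 : E)).isPreconnected
  have hcont : ContinuousOn (fun v : E => c + ((r + ‖v‖) / ‖v‖) • v) {0}ᶜ := by
    refine continuousOn_const.add (ContinuousOn.smul (ContinuousOn.div (by fun_prop) (by fun_prop)
      fun v hv => norm_ne_zero_iff.2 hv) continuousOn_id)
  convert h0.image _ hcont using 1
  ext z
  simp only [mem_compl_iff, Metric.mem_closedBall, not_le, mem_image, mem_singleton_iff]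
  constructor
  · intro hz
    rw [dist_eq_norm] at hz
    have hpos : 0 < ‖z - c‖ := hr.trans_lt hz
    have hnorm : ‖((‖z - c‖ - r) / ‖z - c‖) • (z - c)‖ = ‖z - c‖ - r := by
      rw [norm_smul, Real.norm_of_nonneg (div_nonneg (by linarith) hpos.le)]
      field_simp
    refine ⟨((‖z - c‖ - r) / ‖z - c‖) • (z - c), ?_, ?_⟩
    · refine norm_ne_zero_iff.1 ?_
      rw [hnorm]
      linarith
    · rw [hnorm, smul_smul]
      have : (r + (‖z - c‖ - r)) / (‖z - c‖ - r) * ((‖z - c‖ - r) / ‖z - c‖) = 1 := by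
        have : ‖z - c‖ - r ≠ 0 := by linarith
        field_simp
        ring
      rw [this, one_smul, add_sub_cancel]
  · rintro ⟨v, hv, rfl⟩
    have hpos : 0 < ‖v‖ := norm_pos_iff.2 hv
    rw [dist_eq_norm, add_sub_cancel_left, norm_smul,
      Real.norm_of_nonneg (div_nonneg (by positivity) hpos.le), div_mul_cancel₀ _ hpos.ne']
    linarith

theorem compl_closedBall_subset_unboundedComplement (hE : 1 < Module.rank ℝ E) {T : Set E} {c : E}
    {r : ℝ} (hr : 0 ≤ r) (hT : T ⊆ Metric.closedBall c r) :
    (Metric.closedBall c r)ᶜ ⊆ unboundedComplement T := by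
  intro y hy
  refine ⟨_, isPreconnected_compl_closedBall hE c hr, hy, fun hb => ?_,
    disjoint_compl_left_iff_subset.2 hT⟩
  have : Nontrivial E := (rank_pos_iff_nontrivial (R := ℝ)).1 (zero_lt_one.trans hE)
  apply NormedSpace.unbounded_univ ℝ E
  rw [← union_compl_self (Metric.closedBall c r)]
  exact Metric.isBounded_closedBall.union hb

theorem isPreconnected_unboundedComplement (hE : 1 < Module.rank ℝ E) {T : Set E}
    (hT : Bornology.IsBounded T) : IsPreconnected (unboundedComplement T) := by
  obtain ⟨r, hr, hTr⟩ := hT.subset_closedBall_lt 0 (0 : E)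
  have hsub := compl_closedBall_subset_unboundedComplement hE hr.le hTr
  have : Nontrivial E := (rank_pos_iff_nontrivial (R := ℝ)).1 (zero_lt_one.trans hE)
  obtain ⟨z, hz⟩ : (Metric.closedBall (0 : E) r)ᶜ.Nonempty := by
    rw [nonempty_compl]
    intro h
    exact NormedSpace.unbounded_univ ℝ E (h ▸ Metric.isBounded_closedBall)
  refine isPreconnected_of_forall z fun y hy => ?_
  obtain ⟨C, hC, hyC, hCb, hCT⟩ := hy
  obtain ⟨w, hwC, hw⟩ : (C ∩ (Metric.closedBall (0 : E) r)ᶜ).Nonempty := by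
    rw [← not_disjoint_iff_nonempty_inter]
    exact fun h => hCb (Metric.isBounded_closedBall.subset (disjoint_compl_right_iff_subset.1 h))
  refine ⟨C ∪ (Metric.closedBall (0 : E) r)ᶜ, union_subset ?_ hsub, Or.inr hz, Or.inl hyC,
    hC.union w hwC hw (isPreconnected_compl_closedBall hE 0 hr.le)⟩
  exact fun u hu => ⟨C, hC, hu, hCb, hCT⟩

/-- Bounded sets have compact closure here, so homeomorphisms preserve boundedness. -/
theorem image_unboundedComplement [FiniteDimensional ℝ E] (Φ : E ≃ₜ E) (T : Set E) :
    Φ '' unboundedComplement T = unboundedComplement (Φ '' T) := by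
  have key : ∀ (Φ : E ≃ₜ E) (T : Set E),
      Φ '' unboundedComplement T ⊆ unboundedComplement (Φ '' T) := by
    rintro Φ T _ ⟨y, ⟨C, hC, hy, hCb, hCT⟩, rfl⟩
    refine ⟨Φ '' C, hC.image _ Φ.continuous.continuousOn, mem_image_of_mem _ hy, fun hb => hCb ?_,
      (disjoint_image_iff Φ.injective).2 hCT⟩
    have := FiniteDimensional.proper ℝ E
    have h1 := (hb.isCompact_closure.image Φ.symm.continuous).isBounded
    refine h1.subset fun z hz => ⟨Φ z, subset_closure (mem_image_of_mem _ hz), by simp⟩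
  refine Subset.antisymm (key Φ T) fun y hy => ?_
  have := key Φ.symm (Φ '' T) (mem_image_of_mem _ hy)
  rw [← image_comp, Φ.symm_comp_self, image_id] at this
  exact ⟨_, this, by simp⟩

end Separation

/-! ### Self-similar tilings and the absence of cavities. -/

section Tilings

open MeasureTheory

variable {n : ℕ}

theorem volume_image_isometryEquiv (e : EuclideanSpace ℝ (Fin n) ≃ᵢ EuclideanSpace ℝ (Fin n))
    (S : Set (EuclideanSpace ℝ (Fin n))) : volume (e '' S) = volume S := by
  have he : ∀ z, e z = e 0 + e.toRealLinearIsometryEquiv z := by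
    intro z
    simp
  have him : e '' S = (fun z => e 0 + z) '' (e.toRealLinearIsometryEquiv '' S) := by
    rw [image_image]
    exact image_congr fun z _ => he z
  rw [him, image_add_left, measure_preimage_add]
  have h2 := e.toRealLinearIsometryEquiv.symm.measurePreserving.measure_preimage_equiv
    (f := e.toRealLinearIsometryEquiv.symm.toHomeomorph.toMeasurableEquiv) S
  rw [← h2]
  congr 1
  exact e.toRealLinearIsometryEquiv.toEquiv.image_eq_preimage_symm S

/-- `X` is a union of finitely many copies of itself, scaled by `ρ`, with disjoint interiors. -/
def HasTiling (X : Set (EuclideanSpace ℝ (Fin n))) (ρ : ℝ) : Prop :=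
  ∃ (ι : Type) (_ : Finite ι) (g : ι → EuclideanSpace ℝ (Fin n) ≃ᵃ[ℝ] EuclideanSpace ℝ (Fin n)),
    (∀ i x y, dist (g i x) (g i y) = ρ * dist x y) ∧ X = ⋃ i, g i '' X ∧
      ∀ i j, i ≠ j → Disjoint (interior (g i '' X)) (interior (g j '' X))

variable {X : Set (EuclideanSpace ℝ (Fin n))}

theorem AffineEquiv.image_interior_of_finiteDimensional
    (g : EuclideanSpace ℝ (Fin n) ≃ᵃ[ℝ] EuclideanSpace ℝ (Fin n))
    (S : Set (EuclideanSpace ℝ (Fin n))) : g '' interior S = interior (g '' S) :=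
  g.toContinuousAffineEquiv.toHomeomorph.image_interior S

theorem hasTiling_one : HasTiling X 1 := by
  refine ⟨Unit, inferInstance, fun _ => AffineEquiv.refl ℝ _, by simp,
    by rw [iUnion_const]; simp, ?_⟩
  exact fun i j hij => (hij (Subsingleton.elim i j)).elim

theorem HasTiling.mul {ρ σ : ℝ} (hρ : HasTiling X ρ) (hσ : HasTiling X σ) :
    HasTiling X (ρ * σ) := by
  obtain ⟨ι, _, g, hg1, hg2, hg3⟩ := hρ
  obtain ⟨κ, _, h, hh1, hh2, hh3⟩ := hσ
  have himage : ∀ i j, ((h j).trans (g i)) '' X = g i '' (h j '' X) := fun i j => by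
    rw [image_image]; rfl
  have hsub : ∀ j, h j '' X ⊆ X := fun j => by
    conv_rhs => rw [hh2]
    exact subset_iUnion (fun j => h j '' X) j
  refine ⟨ι × κ, inferInstance, fun p => (h p.2).trans (g p.1), ?_, ?_, ?_⟩
  · intro p x y
    simp only [AffineEquiv.trans_apply, hg1, hh1, mul_assoc]
  · simp only [himage, iUnion_prod', ← image_iUnion, ← hh2]
    exact hg2
  · rintro ⟨i, j⟩ ⟨i', j'⟩ hij
    simp only [himage]
    by_cases hi : i = i'
    · subst hi
      have hj : j ≠ j' := fun h => hij (by rw [h])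
      rw [← AffineEquiv.image_interior_of_finiteDimensional (g i) (h j '' X),
        ← AffineEquiv.image_interior_of_finiteDimensional (g i) (h j' '' X), disjoint_image_iff (g i).injective]
      exact hh3 j j' hj
    · exact (hg3 i i' hi).mono (interior_mono (image_mono (hsub j)))
        (interior_mono (image_mono (hsub j')))

theorem HasTiling.pow {ρ : ℝ} (hρ : HasTiling X ρ) (m : ℕ) : HasTiling X (ρ ^ m) := by
  induction m with
  | zero => simpa using hasTiling_one
  | succ m ih => rw [pow_succ]; exact ih.mul hρ

/-- A similarity of Euclidean space is affine. -/
theorem exists_affineEquiv_of_dist_eq {ρ : ℝ} (hρ : 0 < ρ)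
    (e : EuclideanSpace ℝ (Fin n) ≃ EuclideanSpace ℝ (Fin n))
    (he : ∀ x y, dist (e x) (e y) = ρ * dist x y) :
    ∃ g : EuclideanSpace ℝ (Fin n) ≃ᵃ[ℝ] EuclideanSpace ℝ (Fin n), ∀ x, g x = e x := by
  let s : EuclideanSpace ℝ (Fin n) ≃ₗ[ℝ] EuclideanSpace ℝ (Fin n) :=
    LinearEquiv.smulOfNeZero ℝ _ ρ hρ.ne'
  have hs : ∀ x, s x = ρ • x := fun x => rfl
  have hsd : ∀ x y, dist (s x) (s y) = ρ * dist x y := fun x y => by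
    rw [hs, hs, dist_smul₀, Real.norm_of_nonneg hρ.le]
  -- Undoing the scaling leaves an isometry, affine by Mazur–Ulam.
  let i : EuclideanSpace ℝ (Fin n) ≃ᵢ EuclideanSpace ℝ (Fin n) :=
    ⟨s.symm.toEquiv.trans e, Isometry.of_dist_eq fun x y => by
      have h1 := hsd (s.symm x) (s.symm y)
      rw [s.apply_symm_apply, s.apply_symm_apply] at h1
      rw [h1]
      exact he _ _⟩
  refine ⟨s.toAffineEquiv.trans i.toRealAffineIsometryEquiv.toAffineEquiv, fun x => ?_⟩
  change e (s.symm (s x)) = e x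
  rw [s.symm_apply_apply]

theorem DilationEquiv.exists_dist_eq (e : EuclideanSpace ℝ (Fin n) ≃ᵈ EuclideanSpace ℝ (Fin n)) :
    ∃ ρ : ℝ, 0 < ρ ∧ ∀ x y, dist (e x) (e y) = ρ * dist x y :=
  ⟨Dilation.ratio e, Dilation.ratio_pos e, fun x y => Dilation.dist_eq e x y⟩

theorem diam_image_of_dist_eq {f : EuclideanSpace ℝ (Fin n) → EuclideanSpace ℝ (Fin n)} {ρ : ℝ}
    (hρ : 0 ≤ ρ) (hf : ∀ x y, dist (f x) (f y) = ρ * dist x y) (hX : Bornology.IsBounded X) :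
    Metric.diam (f '' X) ≤ ρ * Metric.diam X := by
  refine Metric.diam_le_of_forall_dist_le (mul_nonneg hρ Metric.diam_nonneg) ?_
  rintro _ ⟨x, hx, rfl⟩ _ ⟨y, hy, rfl⟩
  rw [hf]
  exact mul_le_mul_of_nonneg_left (Metric.dist_le_diam_of_mem hX hx hy) hρ

/-- A compact rep-tile is tiled by copies scaled by a ratio smaller than one. -/
theorem IsRepTile.hasTiling [NeZero n] {k : ℕ} (hk : 1 < k) (hX : IsRepTile k X)
    (hc : IsCompact X) : ∃ ρ, 0 < ρ ∧ ρ < 1 ∧ HasTiling X ρ := by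
  obtain ⟨hne, T, hT1, hT2, hT3, hT4⟩ := hX
  have hscale : ∀ i, ∃ (ρ : ℝ) (g : EuclideanSpace ℝ (Fin n) ≃ᵃ[ℝ] EuclideanSpace ℝ (Fin n)),
      0 < ρ ∧ (∀ x y, dist (g x) (g y) = ρ * dist x y) ∧ g '' X = T i := by
    intro i
    obtain ⟨e, he⟩ := hT4 i
    obtain ⟨ρ, hρ, hd⟩ := e.symm.exists_dist_eq
    obtain ⟨g, hg⟩ := exists_affineEquiv_of_dist_eq hρ e.symm.toEquiv hd
    refine ⟨ρ, g, hρ, fun x y => by rw [hg, hg]; exact hd x y, ?_⟩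
    rw [← he, image_image]
    refine (image_congr fun x _ => ?_).trans (image_id' (T i))
    rw [hg]
    exact e.symm_apply_apply x
  choose r g hr hg hgX using hscale
  have hbd := hc.isBounded
  obtain ⟨a, ha, b, hb, hab⟩ : ∃ a ∈ X, ∃ b ∈ X, a ≠ b := by
    obtain ⟨a, ha⟩ := hne
    obtain ⟨v, hv⟩ := exists_ne (0 : EuclideanSpace ℝ (Fin n))
    obtain ⟨t, ht, ht0⟩ := (((tendsto_add_smul a v).eventually
      (mem_interior_iff_mem_nhds.1 ha)).and self_mem_nhdsWithin).exists
    refine ⟨a, interior_subset ha, _, ht, ?_⟩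
    rw [Ne, left_eq_add]
    exact smul_ne_zero ht0 hv
  have hdiam : 0 < Metric.diam X := (dist_pos.2 hab).trans_le (Metric.dist_le_diam_of_mem hbd ha hb)
  have hdg : ∀ i, Metric.diam (T i) = r i * Metric.diam X := by
    intro i
    refine le_antisymm (hgX i ▸ diam_image_of_dist_eq (hr i).le (hg i) hbd) ?_
    have h1 : ∀ x y, dist ((g i).symm x) ((g i).symm y) = (r i)⁻¹ * dist x y := fun x y => by
      have := hg i ((g i).symm x) ((g i).symm y)
      rw [(g i).apply_symm_apply, (g i).apply_symm_apply] at this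
      rw [this, inv_mul_cancel_left₀ (hr i).ne']
    have hTb : Bornology.IsBounded (T i) := by
      refine hbd.subset ?_
      rw [hT1]
      exact subset_iUnion T i
    have h2 := diam_image_of_dist_eq (inv_nonneg.2 (hr i).le) h1 hTb
    have h3 : (g i).symm '' T i = X := by
      rw [← hgX i, image_image]
      simp
    rw [h3] at h2
    rwa [← inv_mul_le_iff₀ (inv_pos.2 (hr i)), inv_inv] at h2
  let z : Fin k := ⟨0, by omega⟩
  let o : Fin k := ⟨1, hk⟩
  have hzo : z ≠ o := by simp [z, o]
  -- Congruent tiles have equal diameters, hence equal ratios.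
  have hr_eq : ∀ i, r i = r z := by
    intro i
    obtain ⟨e, he⟩ := hT3 i z
    have h1 : Metric.diam (T z) = Metric.diam (T i) := by rw [← he, e.diam_image]
    rw [hdg, hdg] at h1
    exact (mul_right_cancel₀ hdiam.ne' h1).symm
  have hTX : ∀ i, T i ⊆ X := fun i => by
    rw [hT1]
    exact subset_iUnion T i
  have hle : r z ≤ 1 := by
    have h1 := Metric.diam_mono (hTX z) hbd
    rw [hdg] at h1
    exact (mul_le_iff_le_one_left hdiam).1 h1
  have hlt : r z < 1 := by
    -- With ratio 1, the interior of `T z` would have the full volume of `interior X`, leaving none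
    -- for the interior of `T o`.
    refine lt_of_le_of_ne hle fun h1 => ?_
    let e : EuclideanSpace ℝ (Fin n) ≃ᵢ EuclideanSpace ℝ (Fin n) :=
      ⟨(g z).toEquiv, Isometry.of_dist_eq fun x y => (hg z x y).trans (by rw [h1, one_mul])⟩
    have hvz : volume (interior (T z)) = volume (interior X) := by
      rw [← hgX z, ← AffineEquiv.image_interior_of_finiteDimensional]
      exact volume_image_isometryEquiv e (interior X)
    have ho : (interior (T o)).Nonempty := by
      rw [← hgX o, ← AffineEquiv.image_interior_of_finiteDimensional]
      exact hne.image _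
    have h2 : volume (interior (T z)) + volume (interior (T o)) ≤ volume (interior X) := by
      rw [← measure_union (hT2 z o hzo) isOpen_interior.measurableSet]
      exact measure_mono (union_subset (interior_mono (hTX z)) (interior_mono (hTX o)))
    rw [hvz] at h2
    have hfin : volume (interior X) ≠ ⊤ :=
      ((measure_mono interior_subset).trans_lt hc.measure_lt_top).ne
    have h3 := ENNReal.le_of_add_le_add_left hfin (h2.trans_eq (add_zero _).symm)
    exact (isOpen_interior.measure_pos volume ho).ne' (nonpos_iff_eq_zero.1 h3)
  refine ⟨r z, hr z, hlt, Fin k, inferInstance, g, fun i x y => ?_, ?_, fun i j hij => ?_⟩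
  · rw [hg, hr_eq]
  · simp only [hgX]
    exact hT1
  · rw [hgX, hgX]
    exact hT2 i j hij

/-- A set with arbitrarily fine tilings by small copies of itself has no cavities. -/
theorem unboundedComplement_eq_compl [NeZero n] (hn : 1 < n) (hc : IsCompact X)
    (hreg : X ⊆ closure (interior X)) (hconn : IsPreconnected (interior X))
    (hpoly : HasPolyhedralFrontier X) (hne : (interior X).Nonempty) {ρ : ℝ} (hρ0 : 0 < ρ)
    (hρ1 : ρ < 1) (htile : HasTiling X ρ) : unboundedComplement X = Xᶜ := by
  have hrank : 1 < Module.rank ℝ (EuclideanSpace ℝ (Fin n)) := by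
    rw [← Module.finrank_eq_rank, finrank_euclideanSpace_fin]
    exact_mod_cast hn
  refine Subset.antisymm (subset_compl_iff_disjoint_right.2 (disjoint_unboundedComplement X)) ?_
  intro v hvX
  by_contra hvU
  obtain ⟨x₀, hx₀⟩ := hne
  obtain ⟨ε, hε, hball⟩ := Metric.nhds_basis_closedBall.mem_iff.1 (mem_interior_iff_mem_nhds.1 hx₀)
  obtain ⟨m, hm⟩ : ∃ m : ℕ, ρ ^ m * Metric.diam X < ε := by
    have h1 : Filter.Tendsto (fun m : ℕ => ρ ^ m * Metric.diam X) Filter.atTop (𝓝 0) := by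
      simpa using (tendsto_pow_atTop_nhds_zero_of_lt_one hρ0.le hρ1).mul_const (Metric.diam X)
    exact (h1.eventually_lt_const hε).exists
  obtain ⟨ι, _, g, hg, hcov, hdisj⟩ := htile.pow m
  have hσ : 0 < ρ ^ m := pow_pos hρ0 m
  let Φ : ι → EuclideanSpace ℝ (Fin n) ≃ₜ EuclideanSpace ℝ (Fin n) :=
    fun i => (g i).toContinuousAffineEquiv.toHomeomorph
  have hΦ : ∀ i x, Φ i x = g i x := fun i x => rfl
  set T : ι → Set (EuclideanSpace ℝ (Fin n)) := fun i => g i '' X with hT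
  have hTc : ∀ i, IsCompact (T i) := fun i => hc.image (Φ i).continuous
  have hTint : ∀ i, interior (T i) = g i '' interior X := fun i =>
    (AffineEquiv.image_interior_of_finiteDimensional (g i) X).symm
  have hTreg : ∀ i, T i ⊆ closure (interior (T i)) := fun i => by
    rw [hTint]
    exact (image_mono hreg).trans (image_closure_subset_closure_image (Φ i).continuous)
  have hTconn : ∀ i, IsPreconnected (interior (T i)) := fun i => by
    rw [hTint]
    exact hconn.image _ (Φ i).continuous.continuousOn
  have hTU : ∀ i, unboundedComplement (T i) = g i '' unboundedComplement X := fun i =>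
    (image_unboundedComplement (Φ i) X).symm
  have hTdisj : ∀ i j, i ≠ j → Disjoint (interior (T j)) (T i) := fun i j hij => by
    refine Disjoint.mono_right (hTreg i) ?_
    exact ((hdisj i j hij).symm).closure_right isOpen_interior
  obtain ⟨i, hi⟩ := mem_iUnion.1 (hcov ▸ hball (Metric.mem_closedBall_self hε.le))
  have hTball : T i ⊆ Metric.closedBall x₀ ε := fun y hy => by
    rw [Metric.mem_closedBall]
    exact (Metric.dist_le_diam_of_mem (hTc i).isBounded hy hi).trans
      ((diam_image_of_dist_eq hσ.le (hg i) hc.isBounded).trans hm.le)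
  set U := unboundedComplement (T i) with hU
  have hUo : IsOpen U := isOpen_unboundedComplement (hTc i).isClosed
  have hfrU : frontier U ⊆ T i := frontier_unboundedComplement_subset (hTc i).isClosed
  have hballU : (Metric.closedBall x₀ ε)ᶜ ⊆ U :=
    compl_closedBall_subset_unboundedComplement hrank hε.le hTball
  -- `V` is the union of the cavities of the small tile; it lies in the ball, hence in `X`.
  set V := (T i ∪ U)ᶜ with hV
  have hTUc : IsClosed (T i ∪ U) := by
    rw [← closure_subset_iff_isClosed, closure_union, (hTc i).isClosed.closure_eq,
      closure_eq_self_union_frontier]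
    exact union_subset subset_union_left
      (union_subset subset_union_right (hfrU.trans subset_union_left))
  have hVo : IsOpen V := hTUc.isOpen_compl
  have hvV : g i v ∈ V := by
    rintro (h | h)
    · exact hvX (((g i).injective.mem_set_image).1 h)
    · rw [hU, hTU] at h
      exact hvU (((g i).injective.mem_set_image).1 h)
  have hgvX : g i v ∈ X := by
    refine hball ?_
    by_contra h
    exact hvV (Or.inr (hballU h))
  obtain ⟨j, hj⟩ := mem_iUnion.1 (hcov ▸ hgvX)
  have hij : i ≠ j := by
    rintro rfl
    exact hvV (Or.inl hj)
  -- The connected interior of `T j` meets `V` and avoids `T i`, which contains the frontier of `V`.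
  have hjV : interior (T j) ⊆ V := by
    obtain ⟨y, hyV, hyj⟩ := mem_closure_iff.1 (hTreg j hj) V hVo hvV
    refine ((hTconn j).subset_or_disjoint_of_disjoint_frontier ?_).resolve_right
      fun h => disjoint_left.1 h hyj hyV
    rw [hV, frontier_compl]
    refine (hTdisj i j hij).mono_right fun y hy => ?_
    rw [hTUc.frontier_eq] at hy
    refine hy.1.resolve_right fun hyU => hy.2 ?_
    exact interior_mono subset_union_right (hUo.interior_eq.symm ▸ hyU)
  have hUj : Disjoint U (T j) := by
    have h1 : Disjoint U V := disjoint_left.2 fun y hyU hyV => hyV (Or.inr hyU)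
    exact (h1.closure_right hUo).mono_right ((hTreg j).trans (closure_mono hjV))
  have hUU : U ⊆ unboundedComplement (T j) := unboundedComplement_subset hUj
  set U' := unboundedComplement (T j) with hU'
  have hU'o : IsOpen U' := isOpen_unboundedComplement (hTc j).isClosed
  have hvol : volume U'ᶜ = volume Uᶜ := by
    let e : EuclideanSpace ℝ (Fin n) ≃ᵢ EuclideanSpace ℝ (Fin n) :=
      ⟨((g i).symm.trans (g j)).toEquiv, Isometry.of_dist_eq fun x y => by
        have h1 := hg i ((g i).symm x) ((g i).symm y)
        rw [(g i).apply_symm_apply, (g i).apply_symm_apply] at h1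
        rw [h1]
        exact hg j _ _⟩
    rw [← volume_image_isometryEquiv e Uᶜ, image_compl_eq e.bijective]
    congr 2
    rw [hU', hTU, hU, hTU, image_image]
    refine image_congr fun x _ => ?_
    change g j x = g j ((g i).symm (g i x))
    rw [(g i).symm_apply_apply]
  have hfin : volume Uᶜ ≠ ⊤ :=
    ((measure_mono (compl_subset_comm.1 hballU)).trans_lt
      (isCompact_closedBall x₀ ε).measure_lt_top).ne
  have hTne : ∀ l, (interior (T l)).Nonempty := fun l => by
    rw [hTint]
    exact ⟨_, mem_image_of_mem _ hx₀⟩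
  have hUeq : U' = U := by
    refine Subset.antisymm (fun y hy => ?_) hUU
    by_contra hyU
    -- If `U'` were larger than `U`, the excess would contain a nonempty open set, of positive
    -- volume, against the equal finite volumes of the complements.
    obtain ⟨O, hO, hOne, hOU', hOU⟩ : ∃ O, IsOpen O ∧ O.Nonempty ∧ O ⊆ U' ∧ Disjoint O U := by
      by_cases hyT : y ∈ T i
      · obtain ⟨z, hzU', hz⟩ := mem_closure_iff.1 (hTreg i hyT) U' hU'o hy
        refine ⟨U' ∩ interior (T i), hU'o.inter isOpen_interior, ⟨z, hzU', hz⟩, inter_subset_left,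
          ?_⟩
        exact (disjoint_unboundedComplement (T i)).symm.mono_left
          (inter_subset_right.trans interior_subset)
      · refine ⟨U' ∩ V, hU'o.inter hVo, ⟨y, hy, fun h => h.elim hyT hyU⟩, inter_subset_left, ?_⟩
        exact disjoint_left.2 fun z hz hzU => hz.2 (Or.inr hzU)
    have h1 : volume U'ᶜ + volume O ≤ volume Uᶜ := by
      rw [← measure_union (disjoint_compl_left_iff_subset.2 hOU') hO.measurableSet]
      exact measure_mono (union_subset (compl_subset_compl.2 hUU)
        (subset_compl_iff_disjoint_right.2 hOU))
    rw [hvol] at h1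
    have h3 := ENNReal.le_of_add_le_add_left hfin (h1.trans_eq (add_zero _).symm)
    exact (hO.measure_pos volume hOne).ne' (nonpos_iff_eq_zero.1 h3)
  have hTpoly : ∀ l, HasPolyhedralFrontier (T l) := by
    intro l
    obtain ⟨F, h1, h2, h3⟩ := hpoly
    refine ⟨(g l).pushFunctional '' F, h1.image _, ?_, ?_⟩
    · rintro _ ⟨f, hf, rfl⟩
      exact (g l).linear_pushFunctional_ne_zero (h2 f hf)
    · have : frontier (T l) = g l '' frontier X := ((Φ l).image_frontier X).symm
      rw [this]
      rintro _ ⟨z, hz, rfl⟩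
      obtain ⟨f, hf, hfz⟩ := h3 hz
      exact ⟨_, ⟨f, hf, rfl⟩, by rwa [AffineEquiv.pushFunctional_apply]⟩
  have hUT : Disjoint U (interior (T i)) :=
    (disjoint_unboundedComplement (T i)).mono_right interior_subset
  have hUT' : Disjoint U (interior (T j)) := hUj.mono_right interior_subset
  have hUne : U.Nonempty := by
    refine Nonempty.mono hballU (nonempty_compl.2 fun h => ?_)
    exact NormedSpace.unbounded_univ ℝ (EuclideanSpace ℝ (Fin n)) (h ▸ Metric.isBounded_closedBall)
  refine false_of_common_polyhedral_boundary (P := ![U, interior (T i), interior (T j)])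
    ?_ ?_ ?_ hUne (hTne i) ?_
  · simpa [Fin.forall_fin_succ] using hUo
  · have hd := hdisj i j hij
    simp only [Fin.forall_fin_succ, Fin.isValue]
    simp
    exact ⟨⟨hUT, hUT'⟩, ⟨hUT.symm, hd⟩, hUT'.symm, hd.symm⟩
  · have h1 := (hTpoly i).mono (frontier_unboundedComplement_subset_frontier (hTc i).isClosed)
    have h2 := (hTpoly i).mono frontier_interior_subset
    have h3 := (hTpoly j).mono frontier_interior_subset
    simp only [Fin.forall_fin_succ]
    simpa using ⟨h1, h2, h3⟩
  · have h1 : frontier U ⊆ closure U := frontier_subset_closure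
    have h2 : frontier U ⊆ closure (interior (T i)) := hfrU.trans (hTreg i)
    -- This is where `U' = U` enters: the frontier of `U` is also that of `U'`, so it lies in `T j`.
    have h3 : frontier U ⊆ closure (interior (T j)) := by
      rw [← hUeq]
      exact (frontier_unboundedComplement_subset (hTc j).isClosed).trans (hTreg j)
    simp only [Fin.forall_fin_succ]
    simpa using ⟨h1, h2, h3⟩

end Tilings

theorem mainTheorem2 (X : Set (EuclideanSpace ℝ (Fin 3))) (hX : Is3DRepTile X) :
    IsConnected (manifoldBoundary X) := by
  obtain ⟨hman, hconn, k, hk, hrep⟩ := hX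
  have hc := hman.1.isCompact
  obtain ⟨ρ, hρ0, hρ1, htile⟩ := hrep.hasTiling hk hc
  have hcompl := unboundedComplement_eq_compl (by norm_num) hc hman.subset_closure_interior
    (hman.isPreconnected_interior hconn.isPreconnected) hman.1.hasPolyhedralFrontier hrep.1 hρ0 hρ1
    htile
  have hrank : 1 < Module.rank ℝ (EuclideanSpace ℝ (Fin 3)) := by
    rw [← Module.finrank_eq_rank, finrank_euclideanSpace_fin]
    norm_num
  have hXc : IsPreconnected Xᶜ := hcompl ▸ isPreconnected_unboundedComplement hrank hc.isBounded
  rw [hman.manifoldBoundary_eq_frontier]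
  constructor
  -- An empty frontier would make `X` clopen, hence empty or the whole unbounded space.
  · rw [nonempty_iff_ne_empty, Ne, ← isClopen_iff_frontier_eq_empty, isClopen_iff]
    rintro (h | h)
    · exact hconn.nonempty.ne_empty h
    · exact NormedSpace.unbounded_univ ℝ (EuclideanSpace ℝ (Fin 3)) (h ▸ hc.isBounded)
  · rw [frontier_eq_closure_inter_closure, hc.isClosed.closure_eq]
    refine isPreconnected_inter_of_union_eq_univ hc.isClosed isClosed_closure hconn.isPreconnected
      hXc.closure ?_
    exact eq_univ_of_univ_subset ((union_compl_self X).symm.subset.trans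
      (union_subset_union_right X subset_closure))
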